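/- Let $\mathbb{R}^\infty=\mathbb{R}^{\mathbb{N}}$ carry its Borel $\sigma$-algebra, and let permutations of finitely many coordinates act on it. A measure on $\mathbb{R}^\infty$ is called exchangeable if it is invariant under all these permutations $g$; a measure on $\mathbb{R}^\infty\times\mathbb{R}^\infty$ if it is invariant under all maps $(x,y)\mapsto(g(x),g(y))$; a map $T:\mathbb{R}^\infty\to\mathbb{R}^\infty$ if $T\circ g=g\circ T$ for all $g$. For $m\in\mathcal{P}(\mathbb{R})$ let $m^\infty$ denote its countable power (the law of an i.i.d. sequence with law $m$), and let $$W_2^2(P,Q)=\inf_\theta\int (s-t)^2\,d\theta(s,t)\in[0,\infty],$$ the infimum being over all couplings $\theta$ of $P,Q\in\mathcal{P}(\mathbb{R})$. A solution of the Monge problem between two probability measures with a given cost is a measurable map $T$ such that the plan $(\mathrm{id},T)_\#$(source) has the two measures as marginals and minimizes the integral of the cost among all plans with these marginals. Let $\mu,\nu$ be exchangeable Borel probability measures on $\mathbb{R}^\infty$ with $\int x_1^2\,d\mu+\int y_1^2\,d\nu<\infty$. A solution of the exchangeable Monge problem for $(\mu,\nu)$ (an exchangeable optimal transport map from $\mu$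 to $\nu$) is a Borel exchangeable map $T$ such that $(\mathrm{id},T)_\#\mu$ has marginals $\mu,\nu$ and minimizes $\int (x_1-y_1)^2\,d\pi$ among all exchangeable measures $\pi$ on $\mathbb{R}^\infty\times\mathbb{R}^\infty$ with marginals $\mu,\nu$. Let $\sigma_\mu,\sigma_\nu$ be the de Finetti mixing measures of $\mu,\nu$, i.e. the probability measures on $\mathcal{P}(\mathbb{R})$ (which exist and are unique) with $\mu=\int m^\infty\,\sigma_\mu(dm)$ and $\nu=\int m^\infty\,\sigma_\nu(dm)$. Then: 1. The exchangeable Monge problem for $(\mu,\nu)$ has a solution if and only if there is a solution $\mathcal{T}:\mathcal{P}(\mathbb{R})\to\mathcal{P}(\mathbb{R})$ of the Monge problem between $\sigma_\mu$ and $\sigma_\nu$ with cost $W_2^2$ such that for $\sigma_\mu$-almost every $m$ the one-dimensional Monge problem between $m$ and $\mathcal{T}(m)$ with cost $(s-t)^2$ has a solution. 2. If $\mu$ is a countable power and $\nu$ is not, then the exchangeable Monge problem for $(\mu,\nu)$ has no solution. Such pairs $(\mu,\nu)$ exist, so the exchangeable Monge problem is not always solvable. -/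

import Mathlib

open MeasureTheory
open scoped ENNReal

noncomputable section

/-! ### Optimal transport with a general cost -/

/-- `π` is a transport plan between `μ` and `ν`: its marginals are `μ` and `ν`. -/
def IsPlan {X Y : Type} [MeasurableSpace X] [MeasurableSpace Y]
    (μ : Measure X) (ν : Measure Y) (π : Measure (X × Y)) : Prop :=
  π.map Prod.fst = μ ∧ π.map Prod.snd = ν

/-- The Kantorovich functional `∫ c dπ` of a `[0, ∞]`-valued cost. -/
def planCost {X Y : Type} [MeasurableSpace X] [MeasurableSpace Y]
    (c : X → Y → ℝ≥0∞) (π : Measure (X × Y)) : ℝ≥0∞ :=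
  ∫⁻ p, c p.1 p.2 ∂π

/-- `π` solves the Kantorovich problem between `μ` and `ν` with cost `c`. -/
def IsKantorovichSolution {X Y : Type} [MeasurableSpace X] [MeasurableSpace Y]
    (c : X → Y → ℝ≥0∞) (μ : Measure X) (ν : Measure Y) (π : Measure (X × Y)) : Prop :=
  IsPlan μ ν π ∧ ∀ π' : Measure (X × Y), IsPlan μ ν π' → planCost c π ≤ planCost c π'

/-- `T` solves the Monge problem between `μ` and `ν` with cost `c`: it is measurable and the plan
`(id, T)_# μ` solves the Kantorovich problem (so in particular `T_# μ = ν`). -/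
def IsMongeSolution {X Y : Type} [MeasurableSpace X] [MeasurableSpace Y]
    (c : X → Y → ℝ≥0∞) (μ : Measure X) (ν : Measure Y) (T : X → Y) : Prop :=
  Measurable T ∧ IsKantorovichSolution c μ ν (μ.map fun x => (x, T x))

/-- The quadratic cost `(s - t)²` on the line. -/
def quadCost (s t : ℝ) : ℝ≥0∞ := ENNReal.ofReal ((s - t) ^ 2)

/-- The squared quadratic Kantorovich distance `W₂²(P, Q) ∈ [0, ∞]` of two laws on the line. -/
def W2sq (P Q : ProbabilityMeasure ℝ) : ℝ≥0∞ :=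
  ⨅ (π : Measure (ℝ × ℝ)) (_ : IsPlan (P : Measure ℝ) (Q : Measure ℝ) π), planCost quadCost π

/-! ### Exchangeability on `ℝ^∞ = (ℕ → ℝ)`; the first coordinate has index `0` -/

/-- A permutation of the coordinates that moves only finitely many of them. -/
def IsFinitaryPerm (s : Equiv.Perm ℕ) : Prop := {i | s i ≠ i}.Finite

/-- The action of a permutation on `ℝ^∞`: `(x_i)_i ↦ (x_{s(i)})_i`. -/
def permAct (s : Equiv.Perm ℕ) (x : ℕ → ℝ) : ℕ → ℝ := fun i => x (s i)

/-- A measure on `ℝ^∞` invariant under all finitary permutations of the coordinates. -/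
def ExchMeasure (μ : Measure (ℕ → ℝ)) : Prop :=
  ∀ s : Equiv.Perm ℕ, IsFinitaryPerm s → μ.map (permAct s) = μ

/-- A measure on `ℝ^∞ × ℝ^∞` invariant under all `(x, y) ↦ (g x, g y)`. -/
def ExchPlan (π : Measure ((ℕ → ℝ) × (ℕ → ℝ))) : Prop :=
  ∀ s : Equiv.Perm ℕ, IsFinitaryPerm s →
    π.map (fun p => (permAct s p.1, permAct s p.2)) = π

/-- A map of `ℝ^∞` commuting with all finitary permutations of the coordinates. -/
def ExchMap (T : (ℕ → ℝ) → (ℕ → ℝ)) : Prop :=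
  ∀ s : Equiv.Perm ℕ, IsFinitaryPerm s → ∀ x, T (permAct s x) = permAct s (T x)

/-- The cost `(x₁ - y₁)²` on `ℝ^∞`. -/
def firstCoordCost (x y : ℕ → ℝ) : ℝ≥0∞ := ENNReal.ofReal ((x 0 - y 0) ^ 2)

/-- `π` solves the exchangeable Kantorovich problem: it minimizes `∫ (x₁ - y₁)² dπ` among the
exchangeable plans between `μ` and `ν`. -/
def IsExchKantorovichSolution (μ ν : Measure (ℕ → ℝ))
    (π : Measure ((ℕ → ℝ) × (ℕ → ℝ))) : Prop :=
  IsPlan μ ν π ∧ ExchPlan π ∧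
    ∀ π' : Measure ((ℕ → ℝ) × (ℕ → ℝ)), IsPlan μ ν π' → ExchPlan π' →
      planCost firstCoordCost π ≤ planCost firstCoordCost π'

/-- `T` solves the exchangeable Monge problem (it is an exchangeable optimal transport map): it is
Borel and exchangeable, and `(id, T)_# μ` solves the exchangeable Kantorovich problem. -/
def IsExchMongeSolution (μ ν : Measure (ℕ → ℝ)) (T : (ℕ → ℝ) → (ℕ → ℝ)) : Prop :=
  Measurable T ∧ ExchMap T ∧ IsExchKantorovichSolution μ ν (μ.map fun x => (x, T x))

/-! ### Countable powers and de Finetti decompositions -/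

/-- The countable power `m^∞`: the law of an i.i.d. sequence with common law `m`. -/
def countablePower (m : ProbabilityMeasure ℝ) : Measure (ℕ → ℝ) :=
  Measure.infinitePi fun _ : ℕ => (m : Measure ℝ)

/-- `μ` is a countable power of a law on the line. -/
def IsCountablePower (μ : Measure (ℕ → ℝ)) : Prop :=
  ∃ m : ProbabilityMeasure ℝ, μ = countablePower m

/-- `σ` is a de Finetti mixing measure of `μ`: a probability measure on `P(ℝ)` with
`μ(B) = ∫ m^∞(B) σ(dm)` for all Borel `B`. (The sigma-algebra on `P(ℝ)` is generated by the
evaluations `m ↦ m(A)`; it is the Borel sigma-algebra of the weak topology.) -/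
def IsDeFinettiMixing (μ : Measure (ℕ → ℝ)) (σ : Measure (ProbabilityMeasure ℝ)) : Prop :=
  IsProbabilityMeasure σ ∧
    ∀ B : Set (ℕ → ℝ), MeasurableSet B → μ B = ∫⁻ m, countablePower m B ∂σ

/-- The marginals admitted in the exchangeable problems: exchangeable Borel probability measures
on `ℝ^∞` whose first coordinate has a finite second moment. -/
def IsExchMarginal (μ : Measure (ℕ → ℝ)) : Prop :=
  IsProbabilityMeasure μ ∧ ExchMeasure μ ∧ Integrable (fun x : ℕ → ℝ => x 0 ^ 2) μ

end

/-! Read as the law of a sequence of pairs, an exchangeable plan is exchangeable, so by de Finetti's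
theorem it is a mixture of powers `θ^∞` of laws `θ` on the plane. Replacing each `θ` by its two
marginals gives a plan between the mixing measures whose `W₂²`-cost is no larger
(`exists_isPlan_planCost_W2sq_le`). Conversely, a plan between the mixing measures lifts at equal
cost: couple each pair of laws monotonically and take i.i.d. pairs (`exists_exchPlan_planCost_eq`).
So the two Kantorovich problems have the same value, which is finite by the second moments.

For maps, an exchangeable `T` acts coordinatewise on almost every i.i.d. sequence
(`ExchMap.exists_coordinatewise`). Hence `T` carries `m^∞` to a power `(S m)^∞`, through a map of
the line carrying `m` to `S m`. Optimality of `T` then forces `S` to be optimal for `W₂²` and almost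
every one of the maps on the line to be optimal.

In the other direction, `m` can be recovered from almost every sequence of law `m^∞` as the limit of
its empirical measures, and this recovery (`directing`) ignores finitary permutations. Therefore `T
x i = t (directing x, x i)` is exchangeable. The maps `t (m, ·)` can be chosen measurably in `m`
because an optimal plan of finite cost on the line is the monotone coupling
(`IsPlan.eq_monotoneCoupling`), which depends measurably on its marginals and can be disintegrated.

The negative result follows since the mixing measure of a countable power is a Dirac mass, and maps
send Dirac masses to Dirac masses. -/

noncomputable section

open ProbabilityTheory Filter Topology

/-! ### Measures on sequence spaces -/

/-- The boxes that restrict finitely many initial coordinates of a sequence. -/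
def initialBoxes (E : Type*) [MeasurableSpace E] : Set (Set (ℕ → E)) :=
  {B | ∃ (n : ℕ) (A : ℕ → Set E), (∀ i, MeasurableSet (A i)) ∧ B = (Finset.range n : Set ℕ).pi A}

theorem isPiSystem_initialBoxes (E : Type*) [MeasurableSpace E] :
    IsPiSystem (initialBoxes E) := by
  rintro _ ⟨n, A, hA, rfl⟩ _ ⟨k, B, hB, rfl⟩ -
  refine ⟨max n k, fun i => (if i < n then A i else Set.univ) ∩ (if i < k then B i else Set.univ),
    fun i => ?_, ?_⟩
  · refine MeasurableSet.inter ?_ ?_ <;> split_ifs <;> first | apply hA | apply hB | exact .univ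
  · ext x
    simp only [Set.mem_inter_iff, Set.mem_pi, Finset.coe_range, Set.mem_Iio]
    constructor
    · rintro ⟨h₁, h₂⟩ i -
      constructor
      · split_ifs with h
        exacts [h₁ i h, trivial]
      · split_ifs with h
        exacts [h₂ i h, trivial]
    · intro h
      constructor
      · intro i hi
        simpa [hi] using (h i (lt_max_of_lt_left hi)).1
      · intro i hi
        simpa [hi] using (h i (lt_max_of_lt_right hi)).2

theorem generateFrom_initialBoxes (E : Type*) [MeasurableSpace E] :
    (MeasurableSpace.pi : MeasurableSpace (ℕ → E)) =
      MeasurableSpace.generateFrom (initialBoxes E) := by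
  classical
  apply le_antisymm
  · refine iSup_le fun i => ?_
    rintro _ ⟨A, hA, rfl⟩
    refine MeasurableSpace.measurableSet_generateFrom
      ⟨i + 1, fun j => if j = i then A else Set.univ, fun j => ?_, ?_⟩
    · dsimp only
      split_ifs
      exacts [hA, .univ]
    · ext x
      simp only [Set.mem_preimage, Set.mem_pi, Finset.coe_range, Set.mem_Iio]
      constructor
      · intro h j _
        split_ifs with hj
        · subst hj; exact h
        · trivial
      · intro h
        simpa using h i (Nat.lt_succ_self i)
  · refine MeasurableSpace.generateFrom_le ?_
    rintro _ ⟨n, A, hA, rfl⟩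
    exact MeasurableSet.pi (Finset.range n).countable_toSet fun i _ => hA i

theorem ext_of_initialBoxes {E : Type*} [MeasurableSpace E] {μ ν : Measure (ℕ → E)}
    [IsProbabilityMeasure μ] [IsProbabilityMeasure ν]
    (h : ∀ (n : ℕ) (A : ℕ → Set E), (∀ i, MeasurableSet (A i)) →
      μ ((Finset.range n : Set ℕ).pi A) = ν ((Finset.range n : Set ℕ).pi A)) : μ = ν := by
  refine ext_of_generate_finite _ (generateFrom_initialBoxes E) (isPiSystem_initialBoxes E) ?_
    (by simp)
  rintro _ ⟨n, A, hA, rfl⟩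
  exact h n A hA

/-- The law of an i.i.d. sequence with common law `θ`. -/
def iidLaw {E : Type*} [MeasurableSpace E] (θ : ProbabilityMeasure E) : Measure (ℕ → E) :=
  Measure.infinitePi fun _ : ℕ => (θ : Measure E)

instance {E : Type*} [MeasurableSpace E] (θ : ProbabilityMeasure E) :
    IsProbabilityMeasure (iidLaw θ) := by
  unfold iidLaw; infer_instance

theorem iidLaw_box {E : Type*} [MeasurableSpace E] (θ : ProbabilityMeasure E) (n : ℕ)
    {A : ℕ → Set E} (hA : ∀ i, MeasurableSet (A i)) :
    iidLaw θ ((Finset.range n : Set ℕ).pi A) =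
      ∏ i ∈ Finset.range n, (θ : Measure E) (A i) :=
  Measure.infinitePi_pi _ fun i _ => hA i

theorem measurable_iidLaw (E : Type*) [MeasurableSpace E] :
    Measurable (iidLaw : ProbabilityMeasure E → Measure (ℕ → E)) := by
  refine Measurable.measure_of_isPiSystem_of_isProbabilityMeasure (generateFrom_initialBoxes E)
    (isPiSystem_initialBoxes E) ?_
  rintro _ ⟨n, A, hA, rfl⟩
  simp_rw [iidLaw_box _ _ hA]
  exact Finset.measurable_prod _ fun i _ =>
    (Measure.measurable_coe (hA i)).comp measurable_subtype_coe

theorem iidLaw_map_eval {E : Type*} [MeasurableSpace E] (θ : ProbabilityMeasure E) (i : ℕ) :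
    (iidLaw θ).map (fun x => x i) = θ :=
  Measure.infinitePi_map_eval _ i

theorem iidLaw_map_injective {E : Type*} [MeasurableSpace E] (θ : ProbabilityMeasure E)
    {φ : ℕ → ℕ} (hφ : Function.Injective φ) :
    (iidLaw θ).map (fun x i => x (φ i)) = iidLaw θ :=
  Measure.map_infinitePi_infinitePi_of_inj hφ

theorem iidLaw_map_pi {E F : Type*} [MeasurableSpace E] [MeasurableSpace F]
    (θ : ProbabilityMeasure E) {f : E → F} (hf : Measurable f) :
    (iidLaw θ).map (fun x i => f (x i)) = iidLaw (θ.map hf.aemeasurable) :=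
  Measure.infinitePi_map_pi _ fun _ => hf

/-! ### Exchangeable sequences -/

/-- A law on a sequence space invariant under all finitary permutations of the coordinates. -/
def ExchSeq {E : Type*} [MeasurableSpace E] (μ : Measure (ℕ → E)) : Prop :=
  ∀ s : Equiv.Perm ℕ, IsFinitaryPerm s → μ.map (fun x i => x (s i)) = μ

theorem IsFinitaryPerm.mul {s t : Equiv.Perm ℕ} (hs : IsFinitaryPerm s) (ht : IsFinitaryPerm t) :
    IsFinitaryPerm (s * t) := by
  refine (hs.union ht).subset fun i hi => ?_
  by_contra h
  simp only [Set.mem_union, Set.mem_ofPred_eq, not_or, not_not] at h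
  exact hi (by rw [Equiv.Perm.mul_apply, h.2, h.1])

theorem isFinitaryPerm_swap (a b : ℕ) : IsFinitaryPerm (Equiv.swap a b) := by
  refine (Set.toFinite {a, b}).subset fun i hi => ?_
  by_contra h
  simp only [Set.mem_insert_iff, Set.mem_singleton_iff, not_or] at h
  exact hi (Equiv.swap_apply_of_ne_of_ne h.1 h.2)

/-- Composing with the swap of `s n` and `φ n` corrects the value at `n`; by injectivity it leaves
the earlier values alone. -/
theorem exists_isFinitaryPerm_eq {φ : ℕ → ℕ} (hφ : Function.Injective φ) (n : ℕ) :
    ∃ s : Equiv.Perm ℕ, IsFinitaryPerm s ∧ ∀ i < n, s i = φ i := by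
  induction n with
  | zero => exact ⟨1, by simp [IsFinitaryPerm], by simp⟩
  | succ n ih =>
    obtain ⟨s, hs, h⟩ := ih
    refine ⟨Equiv.swap (s n) (φ n) * s, (isFinitaryPerm_swap _ _).mul hs, fun i hi => ?_⟩
    rw [Equiv.Perm.mul_apply]
    rcases Nat.lt_succ_iff_lt_or_eq.1 hi with hi | rfl
    · rw [Equiv.swap_apply_of_ne_of_ne, h i hi]
      · exact fun h' => hi.ne (s.injective h')
      · rw [h i hi]
        exact fun h' => hi.ne (hφ h')
    · exact Equiv.swap_apply_left _ _

/-- An exchangeable law is invariant under all injective relabelings of the coordinates. -/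
theorem ExchSeq.map_injective {E : Type*} [MeasurableSpace E] {μ : Measure (ℕ → E)}
    [IsProbabilityMeasure μ] (hμ : ExchSeq μ) {φ : ℕ → ℕ} (hφ : Function.Injective φ) :
    μ.map (fun x i => x (φ i)) = μ := by
  have hm : ∀ ψ : ℕ → ℕ, Measurable fun (x : ℕ → E) i => x (ψ i) := fun ψ => by fun_prop
  have := Measure.isProbabilityMeasure_map (μ := μ) (hm φ).aemeasurable
  refine ext_of_initialBoxes fun n A hA => ?_
  have hB : MeasurableSet ((Finset.range n : Set ℕ).pi A) :=
    MeasurableSet.pi (Finset.range n).countable_toSet fun i _ => hA i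
  -- The box sees only `n` coordinates, so `φ` may be replaced by a finitary permutation.
  obtain ⟨s, hs, h⟩ := exists_isFinitaryPerm_eq hφ n
  conv_rhs => rw [← hμ s hs]
  rw [Measure.map_apply (hm _) hB, Measure.map_apply (hm _) hB]
  congr 1
  ext x
  simp only [Set.mem_preimage, Set.mem_pi, Finset.coe_range, Set.mem_Iio]
  exact forall₂_congr fun i hi => by rw [h i hi]

theorem exchSeq_iidLaw {E : Type*} [MeasurableSpace E] (θ : ProbabilityMeasure E) :
    ExchSeq (iidLaw θ) := fun s _ => iidLaw_map_injective θ s.injective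

/-- Two `[0, 1]`-valued functions with the same second moments and the same mixed moment agree
almost everywhere. -/
theorem ae_eq_of_lintegral_mul_eq {X : Type*} [MeasurableSpace X] {μ : Measure X}
    [IsProbabilityMeasure μ] {u v : X → ℝ≥0∞} (hu : Measurable u) (hv : Measurable v)
    (hu1 : ∀ x, u x ≤ 1) (hv1 : ∀ x, v x ≤ 1)
    (huv : ∫⁻ x, u x * v x ∂μ = ∫⁻ x, v x * v x ∂μ)
    (huu : ∫⁻ x, u x * u x ∂μ = ∫⁻ x, v x * v x ∂μ) : u =ᵐ[μ] v := by
  have key : ∀ {f g : X → ℝ≥0∞}, Measurable f → Measurable g → (∀ x, f x ≤ 1) → (∀ x, g x ≤ 1) →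
      Integrable (fun x => (f x).toReal * (g x).toReal) μ ∧
      ∫ x, (f x).toReal * (g x).toReal ∂μ = (∫⁻ x, f x * g x ∂μ).toReal := by
    intro f g hf hg hf1 hg1
    have hle : ∀ x, f x * g x ≤ 1 := fun x => mul_le_one' (hf1 x) (hg1 x)
    simp_rw [← ENNReal.toReal_mul]
    constructor
    · refine integrable_toReal_of_lintegral_ne_top (hf.mul hg).aemeasurable (ne_of_lt ?_)
      calc ∫⁻ x, f x * g x ∂μ ≤ ∫⁻ _, 1 ∂μ := lintegral_mono hle
        _ < ∞ := by simp
    · exact integral_toReal (hf.mul hg).aemeasurable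
        (ae_of_all _ fun x => (hle x).trans_lt ENNReal.one_lt_top)
  have h1 := key hu hu hu1 hu1
  have h2 := key hu hv hu1 hv1
  have h3 := key hv hv hv1 hv1
  -- In `L²`, the hypotheses say `‖u - v‖² = ‖u‖² - 2⟨u, v⟩ + ‖v‖² = 0`.
  have h0 : ∫ x, ((u x).toReal - (v x).toReal) ^ 2 ∂μ = 0 := by
    have : ∀ x, ((u x).toReal - (v x).toReal) ^ 2 = (u x).toReal * (u x).toReal -
        2 * ((u x).toReal * (v x).toReal) + (v x).toReal * (v x).toReal := fun x => by ring
    simp_rw [this]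
    have h12 : Integrable (fun x => (u x).toReal * (u x).toReal -
        2 * ((u x).toReal * (v x).toReal)) μ := h1.1.sub (h2.1.const_mul 2)
    rw [integral_add h12 h3.1, integral_sub h1.1 (h2.1.const_mul 2),
      integral_const_mul, h1.2, h2.2, h3.2, huv, huu]
    ring
  have hint : Integrable (fun x => ((u x).toReal - (v x).toReal) ^ 2) μ := by
    have := (h1.1.sub (h2.1.const_mul 2)).add h3.1
    refine this.congr (ae_of_all _ fun x => ?_)
    simp only [Pi.add_apply, Pi.sub_apply]
    ring
  rw [integral_eq_zero_iff_of_nonneg (fun x => sq_nonneg _) hint] at h0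
  filter_upwards [h0] with x hx
  have hx' : (u x).toReal = (v x).toReal := by simpa [sub_eq_zero] using hx
  exact (ENNReal.toReal_eq_toReal_iff' ((hu1 x).trans_lt ENNReal.one_lt_top).ne
    ((hv1 x).trans_lt ENNReal.one_lt_top).ne).1 hx'

/-- The shift of a sequence. -/
def seqShift {E : Type*} (x : ℕ → E) : ℕ → E := fun i => x (i + 1)

theorem measurable_seqShift {E : Type*} [MeasurableSpace E] :
    Measurable (seqShift : (ℕ → E) → (ℕ → E)) := by
  unfold seqShift; fun_prop

theorem ExchSeq.map_seqShift {E : Type*} [MeasurableSpace E] {μ : Measure (ℕ → E)}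
    [IsProbabilityMeasure μ] (hμ : ExchSeq μ) : μ.map seqShift = μ :=
  hμ.map_injective (φ := fun i => i + 1) (fun a b h => by simpa using h)

/-! ### De Finetti's theorem over a standard Borel space -/

section DeFinetti

variable {E : Type*} [MeasurableSpace E] [StandardBorelSpace E] [Nonempty E]
  {μ : Measure (ℕ → E)} [IsProbabilityMeasure μ]

/-- The conditional law of the first coordinate of a sequence given the others. -/
def headGivenTail (μ : Measure (ℕ → E)) [IsProbabilityMeasure μ] : Kernel (ℕ → E) E :=
  condDistrib (fun x : ℕ → E => x 0) seqShift μ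

instance : IsMarkovKernel (headGivenTail μ) := by unfold headGivenTail; infer_instance

theorem lintegral_indicator_mul_seqShift {A : Set E} (hA : MeasurableSet A)
    {h : (ℕ → E) → ℝ≥0∞} (hh : Measurable h) :
    ∫⁻ x, A.indicator 1 (x 0) * h (seqShift x) ∂μ =
      ∫⁻ x, headGivenTail μ (seqShift x) A * h (seqShift x) ∂μ := by
  have h0 : Measurable fun x : ℕ → E => x 0 := measurable_pi_apply 0
  have hi : Measurable (A.indicator (1 : E → ℝ≥0∞)) := measurable_one.indicator hA
  have e := compProd_map_condDistrib (mβ := MeasurableSpace.pi) (X := seqShift) (μ := μ)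
    h0.aemeasurable
  have hg : Measurable fun p : (ℕ → E) × E => A.indicator (1 : E → ℝ≥0∞) p.2 * h p.1 :=
    (hi.comp measurable_snd).mul (hh.comp measurable_fst)
  have h1 : ∫⁻ x, A.indicator 1 (x 0) * h (seqShift x) ∂μ =
      ∫⁻ p, A.indicator 1 p.2 * h p.1 ∂(μ.map fun x => (seqShift x, x 0)) := by
    rw [lintegral_map hg (measurable_seqShift.prodMk h0)]
  rw [h1, ← e, Measure.lintegral_compProd hg,
    lintegral_map (Measurable.lintegral_kernel_prod_right hg) measurable_seqShift]
  refine lintegral_congr fun x => ?_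
  dsimp only
  rw [lintegral_mul_const _ hi, lintegral_indicator_one hA]
  rfl

/-- Dropping one more coordinate from the conditioning does not change the conditional probability.
With `u` the conditional probability given the tail, exchangeability makes `u` and `u ∘ seqShift`
correlate equally with the head event. Conditioning on the tail then gives `⟨u, u ∘ seqShift⟩ = ‖u‖²
= ‖u ∘ seqShift‖²`, so the two agree almost everywhere. -/
theorem headGivenTail_ae_eq_seqShift (hμ : ExchSeq μ) {A : Set E} (hA : MeasurableSet A) :
    ∀ᵐ x ∂μ, headGivenTail μ x A = headGivenTail μ (seqShift x) A := by
  have hk : Measurable fun x => headGivenTail μ x A := Kernel.measurable_coe _ hA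
  have hi : Measurable fun x : ℕ → E => A.indicator (1 : E → ℝ≥0∞) (x 0) :=
    (measurable_one.indicator hA).comp (measurable_pi_apply 0)
  have hs := measurable_seqShift (E := E)
  have hinv : ∀ {g : (ℕ → E) → ℝ≥0∞}, Measurable g →
      ∫⁻ x, g (seqShift x) ∂μ = ∫⁻ x, g x ∂μ := fun {g} hg => by
    conv_rhs => rw [← hμ.map_seqShift, lintegral_map hg hs]
  set u : (ℕ → E) → ℝ≥0∞ := fun x => headGivenTail μ (seqShift x) A with hu
  have hum : Measurable u := hk.comp hs
  have h1 : ∀ x, headGivenTail μ x A ≤ 1 := fun x => prob_le_one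
  have hA0 : ∫⁻ x, A.indicator 1 (x 0) * u (seqShift x) ∂μ =
      ∫⁻ x, A.indicator 1 (x 0) * u x ∂μ := by
    -- Deleting the coordinate of index `1` keeps the head and turns the tail into the twice shifted
    -- sequence.
    have hφ : Function.Injective fun i : ℕ => if i = 0 then 0 else i + 1 := by
      intro a b h
      dsimp only at h
      split_ifs at h <;> omega
    have hc : Measurable fun (x : ℕ → E) (i : ℕ) => x (if i = 0 then 0 else i + 1) := by fun_prop
    have hg : Measurable fun x => A.indicator 1 (x 0) * u x := hi.mul hum
    conv_rhs => rw [← hμ.map_injective hφ, lintegral_map hg hc]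
    rfl
  have huu : Measurable fun x => u x * u x := hum.mul hum
  have huv : u =ᵐ[μ] u ∘ seqShift := by
    refine ae_eq_of_lintegral_mul_eq hum (hum.comp hs) (fun x => h1 _) (fun x => h1 _) ?_ ?_
    · have e1 := lintegral_indicator_mul_seqShift (μ := μ) hA hum
      have e2 := lintegral_indicator_mul_seqShift (μ := μ) hA hk
      simp only [Function.comp_apply]
      rw [← e1, hA0, e2, hinv huu]
    · exact (hinv huu).symm
  have h2 : ∀ᵐ x ∂(μ.map seqShift), headGivenTail μ x A = headGivenTail μ (seqShift x) A := by
    rw [ae_map_iff hs.aemeasurable (measurableSet_eq_fun hk hum)]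
    exact huv
  rwa [hμ.map_seqShift] at h2

/-- The weight `h` drives the induction. Conditioning on the tail turns the constraint on the head
into a factor that is almost surely shift invariant; stationarity undoes the shift, and the factor
is absorbed into the weight for the remaining, shorter box. -/
theorem lintegral_box_mul_of_ae_eq_seqShift (hμ : ExchSeq μ) (n : ℕ) :
    ∀ {A : ℕ → Set E}, (∀ i, MeasurableSet (A i)) → ∀ {h : (ℕ → E) → ℝ≥0∞}, Measurable h →
      (∀ᵐ x ∂μ, h x = h (seqShift x)) →
      ∫⁻ x, ((Finset.range n : Set ℕ).pi A).indicator 1 x * h x ∂μ =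
        ∫⁻ x, (∏ i ∈ Finset.range n, headGivenTail μ x (A i)) * h x ∂μ := by
  induction n with
  | zero => intro A _ h _ _; simp
  | succ n ih =>
    intro A hA h hh hinv
    have hs := measurable_seqShift (E := E)
    have hk : ∀ i, Measurable fun x => headGivenTail μ x (A i) :=
      fun i => Kernel.measurable_coe _ (hA i)
    set B := (Finset.range n : Set ℕ).pi fun i => A (i + 1) with hB
    have hBm : MeasurableSet B :=
      MeasurableSet.pi (Finset.range n).countable_toSet fun i _ => hA (i + 1)
    have hBi : Measurable (B.indicator (1 : (ℕ → E) → ℝ≥0∞)) := measurable_one.indicator hBm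
    have hbox : ∀ x : ℕ → E,
        ((Finset.range (n + 1) : Set ℕ).pi A).indicator (1 : (ℕ → E) → ℝ≥0∞) x =
        (A 0).indicator 1 (x 0) * B.indicator 1 (seqShift x) := by
      intro x
      have : x ∈ (Finset.range (n + 1) : Set ℕ).pi A ↔ x 0 ∈ A 0 ∧ seqShift x ∈ B := by
        simp only [hB, Set.mem_pi, Finset.coe_range, Set.mem_Iio, seqShift]
        constructor
        · exact fun h => ⟨h 0 (by omega), fun i hi => h (i + 1) (by omega)⟩
        · rintro ⟨h0, h1⟩ (_ | i) hi
          exacts [h0, h1 i (by omega)]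
      by_cases h0 : x 0 ∈ A 0 <;> by_cases h1 : seqShift x ∈ B <;>
        simp only [Set.indicator, this, h0, h1] <;> simp
    calc ∫⁻ x, ((Finset.range (n + 1) : Set ℕ).pi A).indicator 1 x * h x ∂μ
        = ∫⁻ x, (A 0).indicator 1 (x 0) * (fun y => B.indicator 1 y * h y) (seqShift x) ∂μ := by
          refine lintegral_congr_ae ?_
          filter_upwards [hinv] with x hx
          rw [hbox, hx, mul_assoc]
      _ = ∫⁻ x, (fun y => headGivenTail μ y (A 0) * (B.indicator 1 y * h y)) (seqShift x) ∂μ :=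
          lintegral_indicator_mul_seqShift (hA 0) (hBi.mul hh)
      _ = ∫⁻ x, B.indicator 1 x * (headGivenTail μ x (A 0) * h x) ∂μ := by
          have hg : Measurable fun y => headGivenTail μ y (A 0) * (B.indicator 1 y * h y) :=
            (hk 0).mul (hBi.mul hh)
          rw [← lintegral_map hg hs, hμ.map_seqShift]
          exact lintegral_congr fun x => by ring
      _ = ∫⁻ x, (∏ i ∈ Finset.range n, headGivenTail μ x (A (i + 1))) *
            (headGivenTail μ x (A 0) * h x) ∂μ := by
          refine ih (fun i => hA (i + 1)) ((hk 0).mul hh) ?_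
          filter_upwards [hinv, headGivenTail_ae_eq_seqShift hμ (hA 0)] with x hx hx'
          rw [hx, hx']
      _ = _ := by
          refine lintegral_congr fun x => ?_
          rw [Finset.prod_range_succ', mul_assoc]

/-- **De Finetti's theorem**: an exchangeable law on sequences is a mixture of i.i.d. laws. -/
theorem ExchSeq.exists_mixing (hμ : ExchSeq μ) :
    ∃ Ξ : Measure (ProbabilityMeasure E), IsProbabilityMeasure Ξ ∧ Ξ.bind iidLaw = μ := by
  -- The mixing measure is the law of the conditional distribution of the head, evaluated at the
  -- sequence itself; stationarity allows this in place of its tail.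
  let ξ : (ℕ → E) → ProbabilityMeasure E := fun x => ⟨headGivenTail μ x, inferInstance⟩
  have hξ : Measurable ξ := (headGivenTail μ).measurable.subtype_mk
  have hp : IsProbabilityMeasure (μ.map ξ) := Measure.isProbabilityMeasure_map hξ.aemeasurable
  have hb : IsProbabilityMeasure ((μ.map ξ).bind iidLaw) :=
    isProbabilityMeasure_bind (measurable_iidLaw E).aemeasurable
      (ae_of_all _ fun θ => inferInstance)
  refine ⟨μ.map ξ, hp, ext_of_initialBoxes fun n A hA => ?_⟩
  have hB : MeasurableSet ((Finset.range n : Set ℕ).pi A) :=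
    MeasurableSet.pi (Finset.range n).countable_toSet fun i _ => hA i
  have hg : Measurable fun θ : ProbabilityMeasure E => iidLaw θ ((Finset.range n : Set ℕ).pi A) :=
    (Measure.measurable_coe hB).comp (measurable_iidLaw E)
  rw [Measure.bind_apply hB (measurable_iidLaw E).aemeasurable, lintegral_map hg hξ]
  have := lintegral_box_mul_of_ae_eq_seqShift hμ n hA (h := fun _ => 1) measurable_const
    (ae_of_all _ fun _ => rfl)
  simp only [mul_one] at this
  rw [lintegral_indicator_one hB] at this
  rw [this]
  exact lintegral_congr fun x => iidLaw_box _ n hA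

end DeFinetti

/-! ### The directing measure of a real sequence -/

/-- The upper limit of the empirical distribution functions of a sequence at rational points. -/
def empiricalCDF (x : ℕ → ℝ) (q : ℚ) : ℝ :=
  limsup (fun n : ℕ => (∑ i ∈ Finset.range n, (Set.Iic (q : ℝ)).indicator (1 : ℝ → ℝ) (x i)) / n)
    atTop

theorem measurable_empiricalCDF : Measurable empiricalCDF := by
  refine measurable_pi_iff.2 fun q => Measurable.limsup fun n => ?_
  refine Measurable.div_const (Finset.measurable_sum _ fun i _ => ?_) _
  exact (measurable_one.indicator measurableSet_Iic).comp (measurable_pi_apply i)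

/-- Beyond the last moved index, the permutation only rearranges the terms of the empirical sum. The
equality holds for every sequence, as `ExchMap` demands, which is why an upper limit is used instead
of an almost sure limit. -/
theorem empiricalCDF_permAct {s : Equiv.Perm ℕ} (hs : IsFinitaryPerm s) (x : ℕ → ℝ) :
    empiricalCDF (permAct s x) = empiricalCDF x := by
  funext q
  obtain ⟨N, hN⟩ := hs.bddAbove
  refine limsup_congr ?_
  filter_upwards [eventually_gt_atTop N] with n hn
  congr 1
  have hfix : ∀ i, n ≤ i → s i = i := fun i hi => by
    by_contra h
    exact absurd (hN h) (by omega)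
  refine Finset.sum_bij (fun i _ => s i) (fun i hi => ?_) (fun a _ b _ h => s.injective h)
    (fun j hj => ⟨s.symm j, ?_, s.apply_symm_apply j⟩) (fun i _ => rfl)
  · rw [Finset.mem_range] at hi ⊢
    by_contra! h
    have := s.injective (hfix _ h)
    omega
  · rw [Finset.mem_range] at hj ⊢
    by_contra! h
    have := hfix _ h
    rw [s.apply_symm_apply] at this
    omega

/-- A measurable choice of a probability measure with given distribution function at rational
points. -/
def ofRatCDF (g : ℚ → ℝ) : ProbabilityMeasure ℝ :=
  ⟨(stieltjesOfMeasurableRat (fun g : ℚ → ℝ => g) measurable_id g).measure, inferInstance⟩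

theorem measurable_ofRatCDF : Measurable ofRatCDF :=
  (measurable_measure_stieltjesOfMeasurableRat measurable_id).subtype_mk

theorem isRatStieltjesPoint_cdf (m : Measure ℝ) :
    IsRatStieltjesPoint (fun g : ℚ → ℝ => g) fun q => cdf m q where
  mono a b h := monotone_cdf m (by exact_mod_cast h)
  tendsto_atTop_one := (tendsto_cdf_atTop m).comp (tendsto_ratCast_atTop_iff.2 tendsto_id)
  tendsto_atBot_zero := (tendsto_cdf_atBot m).comp (tendsto_ratCast_atBot_iff.2 tendsto_id)
  iInf_rat_gt_eq t := by
    dsimp only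
    rw [← StieltjesFunction.iInf_rat_gt_eq (cdf m) t]
    refine Equiv.iInf_congr (Equiv.subtypeEquivRight fun r => ?_) fun r => rfl
    simp

theorem ofRatCDF_cdf (m : ProbabilityMeasure ℝ) :
    ofRatCDF (fun q => cdf (m : Measure ℝ) q) = m := by
  apply Subtype.ext
  have : IsProbabilityMeasure (ofRatCDF fun q => cdf (m : Measure ℝ) q).1 := (ofRatCDF _).2
  refine ext_of_generate_finite _ Real.borel_eq_generateFrom_Iic_rat Real.isPiSystem_Iic_rat ?_ ?_
  · intro A hA
    simp only [Set.mem_iUnion, Set.mem_singleton_iff] at hA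
    obtain ⟨q, rfl⟩ := hA
    simp only [ofRatCDF]
    rw [measure_stieltjesOfMeasurableRat_Iic, stieltjesOfMeasurableRat_eq,
      toRatCDF_of_isRatStieltjesPoint (isRatStieltjesPoint_cdf _), ofReal_cdf]
    rfl
  · have h1 : (ofRatCDF fun q => cdf (m : Measure ℝ) q).1 Set.univ = 1 :=
      (ofRatCDF _).2.measure_univ
    rw [h1, m.2.measure_univ]

/-- The directing measure of a sequence: the limit of its empirical measures, if it exists. -/
def directing (x : ℕ → ℝ) : ProbabilityMeasure ℝ := ofRatCDF (empiricalCDF x)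

theorem measurable_directing : Measurable directing :=
  measurable_ofRatCDF.comp measurable_empiricalCDF

theorem directing_permAct {s : Equiv.Perm ℕ} (hs : IsFinitaryPerm s) (x : ℕ → ℝ) :
    directing (permAct s x) = directing x := by
  rw [directing, directing, empiricalCDF_permAct hs]

/-- The strong law of large numbers at each of the countably many rational points; a law on the line
is determined by its distribution function there. -/
theorem directing_ae_eq (m : ProbabilityMeasure ℝ) : ∀ᵐ x ∂iidLaw m, directing x = m := by
  have hq : ∀ q : ℚ, ∀ᵐ x ∂iidLaw m, empiricalCDF x q = cdf (m : Measure ℝ) q := by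
    intro q
    set f : ℝ → ℝ := (Set.Iic (q : ℝ)).indicator 1 with hf
    have hfm : Measurable f := measurable_one.indicator measurableSet_Iic
    have hlaw : ∀ i, (iidLaw m).map (fun x => x i) = m := iidLaw_map_eval m
    have hfi : Integrable f (m : Measure ℝ) :=
      (integrable_const (1 : ℝ)).indicator measurableSet_Iic
    have hint : Integrable (fun x : ℕ → ℝ => f (x 0)) (iidLaw m) := by
      rw [← hlaw 0] at hfi
      exact hfi.comp_measurable (measurable_pi_apply 0)
    have hmean : ∫ x, f (x 0) ∂iidLaw m = cdf (m : Measure ℝ) q := by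
      rw [← integral_map (φ := fun x : ℕ → ℝ => x 0) (measurable_pi_apply 0).aemeasurable
        hfm.aestronglyMeasurable, hlaw 0, hf, integral_indicator_one measurableSet_Iic,
        cdf_eq_real]
    have hind : iIndepFun (fun i (x : ℕ → ℝ) => f (x i)) (iidLaw m) :=
      iIndepFun_infinitePi fun _ => hfm
    have := strong_law_ae_real (μ := iidLaw m) (fun i x => f (x i)) hint
      (fun i j hij => hind.indepFun hij) fun i =>
        (IdentDistrib.mk (measurable_pi_apply i).aemeasurable (measurable_pi_apply 0).aemeasurable
          ((hlaw i).trans (hlaw 0).symm)).comp hfm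
    filter_upwards [this] with x hx
    rw [hmean] at hx
    exact hx.limsup_eq
  filter_upwards [ae_all_iff.2 hq] with x hx
  rw [directing, funext hx, ofRatCDF_cdf]

/-- The mixing measure of a mixture of i.i.d. laws is the law of its directing measure. -/
theorem map_directing_bind_iidLaw (σ : Measure (ProbabilityMeasure ℝ)) :
    (σ.bind iidLaw).map directing = σ := by
  ext A hA
  rw [Measure.map_apply measurable_directing hA,
    Measure.bind_apply (measurable_directing hA) (measurable_iidLaw ℝ).aemeasurable]
  have : ∀ m : ProbabilityMeasure ℝ, iidLaw m (directing ⁻¹' A) = A.indicator 1 m := by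
    intro m
    by_cases hm : m ∈ A
    · rw [Set.indicator_of_mem hm, Pi.one_apply, ← prob_compl_eq_zero_iff (measurable_directing hA)]
      refine measure_mono_null (fun x hx => ?_) (directing_ae_eq m)
      exact fun h => hx (show directing x ∈ A from h ▸ hm)
    · rw [Set.indicator_of_notMem hm]
      refine measure_mono_null (fun x hx => ?_) (directing_ae_eq m)
      exact fun h => hm (h ▸ hx)
  simp_rw [this]
  exact lintegral_indicator_one hA

theorem isDeFinettiMixing_iff {μ : Measure (ℕ → ℝ)} {σ : Measure (ProbabilityMeasure ℝ)} :
    IsDeFinettiMixing μ σ ↔ IsProbabilityMeasure σ ∧ σ.bind iidLaw = μ := by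
  refine and_congr_right fun _ => ⟨fun h => ?_, ?_⟩
  · ext B hB
    rw [h B hB, Measure.bind_apply hB (measurable_iidLaw ℝ).aemeasurable]
    rfl
  · rintro rfl B hB
    rw [Measure.bind_apply hB (measurable_iidLaw ℝ).aemeasurable]
    rfl

theorem IsDeFinettiMixing.eq_map_directing {μ : Measure (ℕ → ℝ)}
    {σ : Measure (ProbabilityMeasure ℝ)} (h : IsDeFinettiMixing μ σ) : σ = μ.map directing := by
  rw [← (isDeFinettiMixing_iff.1 h).2, map_directing_bind_iidLaw]

theorem ExchMeasure.existsUnique_isDeFinettiMixing {μ : Measure (ℕ → ℝ)} [IsProbabilityMeasure μ]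
    (hμ : ExchMeasure μ) :
    ∃! σ : Measure (ProbabilityMeasure ℝ), IsDeFinettiMixing μ σ := by
  obtain ⟨σ, hσ⟩ := ExchSeq.exists_mixing (μ := μ) hμ
  have h := isDeFinettiMixing_iff.2 hσ
  exact ⟨σ, h, fun τ hτ => hτ.eq_map_directing.trans h.eq_map_directing.symm⟩

/-! ### Quadratic optimal transport on the line -/

/-- The pairs `(s, t)` such that both coordinates of `p` lie in `[s, t)`. -/
def upCross (p : ℝ × ℝ) : Set (ℝ × ℝ) := {z | z.1 ≤ min p.1 p.2 ∧ max p.1 p.2 < z.2}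

/-- The pairs `(s, t)` such that both coordinates of `p` lie in `[t, s)`. -/
def downCross (p : ℝ × ℝ) : Set (ℝ × ℝ) := {z | z.2 ≤ min p.1 p.2 ∧ max p.1 p.2 < z.1}

theorem measurableSet_upCross_prod :
    MeasurableSet {w : (ℝ × ℝ) × (ℝ × ℝ) | w.2 ∈ upCross w.1} := by
  have h1 : Measurable fun w : (ℝ × ℝ) × (ℝ × ℝ) => w.2.1 := by fun_prop
  have h2 : Measurable fun w : (ℝ × ℝ) × (ℝ × ℝ) => w.2.2 := by fun_prop
  have h3 : Measurable fun w : (ℝ × ℝ) × (ℝ × ℝ) => min w.1.1 w.1.2 := by fun_prop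
  have h4 : Measurable fun w : (ℝ × ℝ) × (ℝ × ℝ) => max w.1.1 w.1.2 := by fun_prop
  exact (measurableSet_le h1 h3).inter (measurableSet_lt h4 h2)

theorem measurableSet_upCross (p : ℝ × ℝ) : MeasurableSet (upCross p) :=
  measurable_prodMk_left (x := p) measurableSet_upCross_prod

theorem measurableSet_downCross_prod :
    MeasurableSet {w : (ℝ × ℝ) × (ℝ × ℝ) | w.2 ∈ downCross w.1} := by
  have h1 : Measurable fun w : (ℝ × ℝ) × (ℝ × ℝ) => w.2.2 := by fun_prop
  have h2 : Measurable fun w : (ℝ × ℝ) × (ℝ × ℝ) => w.2.1 := by fun_prop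
  have h3 : Measurable fun w : (ℝ × ℝ) × (ℝ × ℝ) => min w.1.1 w.1.2 := by fun_prop
  have h4 : Measurable fun w : (ℝ × ℝ) × (ℝ × ℝ) => max w.1.1 w.1.2 := by fun_prop
  exact (measurableSet_le h1 h3).inter (measurableSet_lt h4 h2)

theorem measurableSet_downCross (p : ℝ × ℝ) : MeasurableSet (downCross p) :=
  measurable_prodMk_left (x := p) measurableSet_downCross_prod

theorem volume_setOf_mem_Ico (s t : ℝ) :
    volume {p : ℝ × ℝ | s ≤ min p.1 p.2 ∧ max p.1 p.2 < t} = ENNReal.ofReal (t - s) ^ 2 := by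
  have : {p : ℝ × ℝ | s ≤ min p.1 p.2 ∧ max p.1 p.2 < t} = Set.Ico s t ×ˢ Set.Ico s t := by
    ext p
    simp only [Set.mem_ofPred_eq, le_min_iff, max_lt_iff, Set.mem_prod, Set.mem_Ico]
    tauto
  rw [this, Measure.volume_eq_prod, Measure.prod_prod, Real.volume_Ico, sq]

/-- `(s - t)²` is the area of the square with side `[s, t)` or `[t, s)`; at most one of the two is
nonempty. -/
theorem quadCost_eq_lintegral (z : ℝ × ℝ) :
    quadCost z.1 z.2 = ∫⁻ p, {w : (ℝ × ℝ) × (ℝ × ℝ) | w.2 ∈ upCross w.1}.indicator 1 (p, z) +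
      {w : (ℝ × ℝ) × (ℝ × ℝ) | w.2 ∈ downCross w.1}.indicator 1 (p, z) := by
  have hm : ∀ {U : Set ((ℝ × ℝ) × (ℝ × ℝ))}, MeasurableSet U →
      Measurable (fun p : ℝ × ℝ => U.indicator (1 : _ × _ → ℝ≥0∞) (p, z)) ∧
      ∫⁻ p, U.indicator (1 : _ × _ → ℝ≥0∞) (p, z) = volume {p | (p, z) ∈ U} := by
    intro U hU
    have hp : Measurable fun p : ℝ × ℝ => (p, z) := measurable_prodMk_right
    refine ⟨(measurable_one.indicator hU).comp hp, ?_⟩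
    have hU' : MeasurableSet {p : ℝ × ℝ | (p, z) ∈ U} := hp hU
    rw [← lintegral_indicator_one hU']
    rfl
  rw [lintegral_add_left (hm measurableSet_upCross_prod).1, (hm measurableSet_upCross_prod).2,
    (hm measurableSet_downCross_prod).2]
  have h1 := volume_setOf_mem_Ico z.1 z.2
  have h2 := volume_setOf_mem_Ico z.2 z.1
  simp only [upCross, downCross, Set.mem_ofPred_eq]
  rw [h1, h2, quadCost]
  rcases le_total z.1 z.2 with h | h
  · rw [ENNReal.ofReal_of_nonpos (sub_nonpos.2 h), ← ENNReal.ofReal_pow (sub_nonneg.2 h),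
      ← neg_sub z.2 z.1, neg_sq]
    simp
  · rw [ENNReal.ofReal_of_nonpos (sub_nonpos.2 h), ← ENNReal.ofReal_pow (sub_nonneg.2 h)]
    simp

theorem planCost_quadCost_eq (θ : Measure (ℝ × ℝ)) [SFinite θ] :
    planCost quadCost θ = ∫⁻ p, θ (upCross p) + θ (downCross p) := by
  have h1 : Measurable ({w : (ℝ × ℝ) × (ℝ × ℝ) | w.2 ∈ upCross w.1}.indicator
      (1 : (ℝ × ℝ) × (ℝ × ℝ) → ℝ≥0∞)) :=
    measurable_one.indicator measurableSet_upCross_prod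
  have h2 : Measurable ({w : (ℝ × ℝ) × (ℝ × ℝ) | w.2 ∈ downCross w.1}.indicator
      (1 : (ℝ × ℝ) × (ℝ × ℝ) → ℝ≥0∞)) :=
    measurable_one.indicator measurableSet_downCross_prod
  rw [planCost]
  simp_rw [quadCost_eq_lintegral]
  rw [lintegral_lintegral_swap]
  · refine lintegral_congr fun p => ?_
    have hp : Measurable fun z : ℝ × ℝ => (p, z) := measurable_prodMk_left
    have h1p : Measurable fun z => {w : (ℝ × ℝ) × (ℝ × ℝ) | w.2 ∈ upCross w.1}.indicator
        (1 : (ℝ × ℝ) × (ℝ × ℝ) → ℝ≥0∞) (p, z) := h1.comp hp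
    rw [lintegral_add_left h1p]
    congr 1
    · rw [← lintegral_indicator_one (s := upCross p) (measurableSet_upCross p)]
      rfl
    · rw [← lintegral_indicator_one (s := downCross p) (measurableSet_downCross p)]
      rfl
  · exact ((h1.comp measurable_swap).add (h2.comp measurable_swap)).aemeasurable

theorem IsPlan.isProbabilityMeasure {X Y : Type} [MeasurableSpace X] [MeasurableSpace Y]
    {μ : Measure X} {ν : Measure Y} {π : Measure (X × Y)} [IsProbabilityMeasure μ]
    (h : IsPlan μ ν π) : IsProbabilityMeasure π := by
  constructor
  have := congrArg (fun ρ => ρ Set.univ) h.1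
  simpa [Measure.map_apply measurable_fst MeasurableSet.univ] using this

section Line

variable {P Q : Measure ℝ} {θ θ' : Measure (ℝ × ℝ)}

theorem IsPlan.fst_Iic (h : IsPlan P Q θ) (a : ℝ) : θ {z | z.1 ≤ a} = P (Set.Iic a) := by
  rw [← h.1, Measure.map_apply measurable_fst measurableSet_Iic]; rfl

theorem IsPlan.snd_Iic (h : IsPlan P Q θ) (a : ℝ) : θ {z | z.2 ≤ a} = Q (Set.Iic a) := by
  rw [← h.2, Measure.map_apply measurable_snd measurableSet_Iic]; rfl

/-- A point with first coordinate at most `a` either has second coordinate at most `b` or crosses.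
This bounds crossing probabilities from below by the marginals alone, hence, with
`planCost_quadCost_eq`, bounds the cost of every plan. -/
theorem IsPlan.sub_le_fst (h : IsPlan P Q θ) (a b : ℝ) :
    P (Set.Iic a) - Q (Set.Iic b) ≤ θ {z | z.1 ≤ a ∧ b < z.2} := by
  rw [tsub_le_iff_left, ← h.fst_Iic, ← h.snd_Iic]
  refine (measure_mono fun z hz => ?_).trans (measure_union_le _ _)
  rcases le_or_gt z.2 b with hb | hb
  exacts [Or.inl hb, Or.inr ⟨hz, hb⟩]

theorem IsPlan.sub_le_snd (h : IsPlan P Q θ) (a b : ℝ) :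
    Q (Set.Iic a) - P (Set.Iic b) ≤ θ {z | z.2 ≤ a ∧ b < z.1} := by
  rw [tsub_le_iff_left, ← h.fst_Iic, ← h.snd_Iic]
  refine (measure_mono fun z hz => ?_).trans (measure_union_le _ _)
  rcases le_or_gt z.1 b with hb | hb
  exacts [Or.inl hb, Or.inr ⟨hz, hb⟩]

/-- The integrand of the lower bound of the transport cost by the distribution functions. -/
def crossGap (P Q : Measure ℝ) (p : ℝ × ℝ) : ℝ≥0∞ :=
  (P (Set.Iic (min p.1 p.2)) - Q (Set.Iic (max p.1 p.2))) +
    (Q (Set.Iic (min p.1 p.2)) - P (Set.Iic (max p.1 p.2)))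

theorem IsPlan.crossGap_le (h : IsPlan P Q θ) (p : ℝ × ℝ) :
    crossGap P Q p ≤ θ (upCross p) + θ (downCross p) :=
  add_le_add (h.sub_le_fst _ _) (h.sub_le_snd _ _)

theorem IsPlan.lintegral_crossGap_le [IsProbabilityMeasure P] (h : IsPlan P Q θ) :
    ∫⁻ p, crossGap P Q p ≤ planCost quadCost θ := by
  have := h.isProbabilityMeasure
  rw [planCost_quadCost_eq]
  exact lintegral_mono h.crossGap_le

/-- Equality in the sum of the two bounds means equality in each, so the mass crossing over the
corner `p` is known; removing it from a half-plane leaves the quadrant. The truncated difference `a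
- (a - b)` on the right is `min a b`, the joint distribution function of the monotone coupling. -/
theorem IsPlan.measure_rect_of_eq [IsProbabilityMeasure P] [IsProbabilityMeasure Q]
    (h : IsPlan P Q θ) {p : ℝ × ℝ} (hp : crossGap P Q p = θ (upCross p) + θ (downCross p)) :
    θ {z | z.1 ≤ p.1 ∧ z.2 ≤ p.2} = P (Set.Iic p.1) - (P (Set.Iic p.1) - Q (Set.Iic p.2)) := by
  have hθ := h.isProbabilityMeasure
  have hfin : ∀ A, θ A ≠ ∞ := fun A => measure_ne_top _ _
  have hup : P (Set.Iic (min p.1 p.2)) - Q (Set.Iic (max p.1 p.2)) = θ (upCross p) := by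
    refine le_antisymm (h.sub_le_fst _ _) ?_
    by_contra! hlt
    exact (ENNReal.add_lt_add_of_lt_of_le (by finiteness) hlt (h.sub_le_snd (min p.1 p.2)
      (max p.1 p.2))).ne hp
  have hdown : Q (Set.Iic (min p.1 p.2)) - P (Set.Iic (max p.1 p.2)) = θ (downCross p) := by
    refine le_antisymm (h.sub_le_snd _ _) ?_
    by_contra! hlt
    exact (ENNReal.add_lt_add_of_le_of_lt (by finiteness) (h.sub_le_fst (min p.1 p.2)
      (max p.1 p.2)) hlt).ne hp
  have hm1 : MeasurableSet {z : ℝ × ℝ | z.1 ≤ p.1} :=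
    measurableSet_le measurable_fst measurable_const
  have hm2 : MeasurableSet {z : ℝ × ℝ | z.2 ≤ p.2} :=
    measurableSet_le measurable_snd measurable_const
  rcases le_total p.1 p.2 with hle | hle
  · rw [upCross, min_eq_left hle, max_eq_right hle] at hup
    rw [hup, ← h.fst_Iic, ← measure_inter_add_sdiff {z : ℝ × ℝ | z.1 ≤ p.1} hm2]
    have hd : {z : ℝ × ℝ | z.1 ≤ p.1} \ {z | z.2 ≤ p.2} = {z | z.1 ≤ p.1 ∧ p.2 < z.2} := by
      ext z; simp
    rw [hd, ENNReal.add_sub_cancel_right (hfin _)]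
    rfl
  · rw [downCross, min_eq_right hle, max_eq_left hle] at hdown
    have hd : {z : ℝ × ℝ | z.2 ≤ p.2} \ {z | z.1 ≤ p.1} = {z | z.2 ≤ p.2 ∧ p.1 < z.1} := by
      ext z; simp
    have hadd := measure_inter_add_sdiff (μ := θ) {z : ℝ × ℝ | z.2 ≤ p.2} hm1
    rw [hd, ← hdown, h.snd_Iic] at hadd
    have hi : {z : ℝ × ℝ | z.2 ≤ p.2} ∩ {z | z.1 ≤ p.1} = {z | z.1 ≤ p.1 ∧ z.2 ≤ p.2} := by
      ext z; simp [and_comm]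
    rw [hi] at hadd
    have hPf : P (Set.Iic p.1) ≠ ∞ := measure_ne_top _ _
    have hQf : Q (Set.Iic p.2) ≠ ∞ := measure_ne_top _ _
    rw [ENNReal.eq_sub_of_add_eq (by finiteness) hadd]
    rcases le_total (P (Set.Iic p.1)) (Q (Set.Iic p.2)) with hPQ | hPQ
    · rw [ENNReal.sub_sub_cancel hQf hPQ, tsub_eq_zero_of_le hPQ, tsub_zero]
    · rw [ENNReal.sub_sub_cancel hPf hPQ, tsub_eq_zero_of_le hPQ, tsub_zero]

/-- Almost every corner suffices: good corners exist arbitrarily close to `(a, b)` from the upper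
right, and a finite measure is continuous from above along quadrants. -/
theorem measure_rect_le_of_ae [IsFiniteMeasure θ']
    (h : ∀ᵐ p : ℝ × ℝ, θ {z | z.1 ≤ p.1 ∧ z.2 ≤ p.2} = θ' {z | z.1 ≤ p.1 ∧ z.2 ≤ p.2})
    (a b : ℝ) : θ {z | z.1 ≤ a ∧ z.2 ≤ b} ≤ θ' {z | z.1 ≤ a ∧ z.2 ≤ b} := by
  have hlim : Tendsto (fun n : ℕ => θ' {z | z.1 ≤ a + 1 / ((n : ℝ) + 1) ∧
      z.2 ≤ b + 1 / ((n : ℝ) + 1)}) atTop (𝓝 (θ' {z | z.1 ≤ a ∧ z.2 ≤ b})) := by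
    have hI : {z : ℝ × ℝ | z.1 ≤ a ∧ z.2 ≤ b} = ⋂ n : ℕ, {z | z.1 ≤ a + 1 / ((n : ℝ) + 1) ∧
        z.2 ≤ b + 1 / ((n : ℝ) + 1)} := by
      ext z
      simp only [Set.mem_ofPred_eq, Set.mem_iInter]
      constructor
      · intro hz n
        have : 0 < 1 / ((n : ℝ) + 1) := Nat.one_div_pos_of_nat
        exact ⟨by linarith, by linarith⟩
      · intro hz
        have ht : ∀ c : ℝ, Tendsto (fun n : ℕ => c + 1 / ((n : ℝ) + 1)) atTop (𝓝 c) := fun c => by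
          simpa using tendsto_one_div_add_atTop_nhds_zero_nat.const_add c
        exact ⟨ge_of_tendsto' (ht a) fun n => (hz n).1, ge_of_tendsto' (ht b) fun n => (hz n).2⟩
    rw [hI]
    refine tendsto_measure_iInter_atTop (fun n => ?_) ?_ ⟨0, measure_ne_top _ _⟩
    · exact ((measurableSet_le measurable_fst measurable_const).inter
        (measurableSet_le measurable_snd measurable_const)).nullMeasurableSet
    · intro n k hnk z hz
      have : 1 / ((k : ℝ) + 1) ≤ 1 / ((n : ℝ) + 1) := Nat.one_div_le_one_div hnk
      exact ⟨hz.1.trans (by linarith), hz.2.trans (by linarith)⟩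
  refine ge_of_tendsto' hlim fun n => ?_
  have hε : 0 < 1 / ((n : ℝ) + 1) := Nat.one_div_pos_of_nat
  set ε := 1 / ((n : ℝ) + 1)
  have hpos : volume (Set.Ioo a (a + ε) ×ˢ Set.Ioo b (b + ε)) ≠ 0 := by
    rw [Measure.volume_eq_prod, Measure.prod_prod, Real.volume_Ioo, Real.volume_Ioo]
    simp [hε]
  obtain ⟨p, hp, hpe⟩ : ∃ p ∈ Set.Ioo a (a + ε) ×ˢ Set.Ioo b (b + ε),
      θ {z | z.1 ≤ p.1 ∧ z.2 ≤ p.2} = θ' {z | z.1 ≤ p.1 ∧ z.2 ≤ p.2} := by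
    by_contra! hno
    exact hpos (measure_mono_null hno h)
  calc θ {z | z.1 ≤ a ∧ z.2 ≤ b} ≤ θ {z | z.1 ≤ p.1 ∧ z.2 ≤ p.2} :=
        measure_mono fun z (hz : z.1 ≤ a ∧ z.2 ≤ b) =>
          (⟨hz.1.trans hp.1.1.le, hz.2.trans hp.2.1.le⟩ : z.1 ≤ p.1 ∧ z.2 ≤ p.2)
    _ = θ' {z | z.1 ≤ p.1 ∧ z.2 ≤ p.2} := hpe
    _ ≤ θ' {z | z.1 ≤ a + ε ∧ z.2 ≤ b + ε} :=
        measure_mono fun z (hz : z.1 ≤ p.1 ∧ z.2 ≤ p.2) =>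
          (⟨hz.1.trans hp.1.2.le, hz.2.trans hp.2.2.le⟩ : z.1 ≤ a + ε ∧ z.2 ≤ b + ε)

theorem ext_of_rect [IsProbabilityMeasure θ] [IsProbabilityMeasure θ']
    (h : ∀ a b, θ {z | z.1 ≤ a ∧ z.2 ≤ b} = θ' {z | z.1 ≤ a ∧ z.2 ≤ b}) : θ = θ' := by
  have hgen : (inferInstance : MeasurableSpace (ℝ × ℝ)) = MeasurableSpace.generateFrom
      (Set.image2 (· ×ˢ ·) (Set.range Set.Iic) (Set.range Set.Iic)) := by
    refine (generateFrom_eq_prod ?_ ?_ ?_ ?_).symm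
    · exact (borel_eq_generateFrom_Iic ℝ).symm.trans (BorelSpace.measurable_eq (α := ℝ)).symm
    · exact (borel_eq_generateFrom_Iic ℝ).symm.trans (BorelSpace.measurable_eq (α := ℝ)).symm
    all_goals
      refine ⟨fun n : ℕ => Set.Iic (n : ℝ), fun n => ⟨_, rfl⟩, ?_⟩
      refine Set.eq_univ_of_forall fun x => ?_
      obtain ⟨n, hn⟩ := exists_nat_ge x
      exact Set.mem_iUnion.2 ⟨n, hn⟩
  refine ext_of_generate_finite _ hgen (isPiSystem_Iic.prod isPiSystem_Iic) ?_ (by simp)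
  rintro _ ⟨_, ⟨a, rfl⟩, _, ⟨b, rfl⟩, rfl⟩
  exact h a b

/-- A plan whose cost attains the lower bound by the distribution functions is determined by its
marginals. -/
theorem IsPlan.eq_of_planCost_le [IsProbabilityMeasure P] [IsProbabilityMeasure Q]
    (h : IsPlan P Q θ) (h' : IsPlan P Q θ') (hfin : ∫⁻ p, crossGap P Q p ≠ ∞)
    (hc : planCost quadCost θ ≤ ∫⁻ p, crossGap P Q p)
    (hc' : planCost quadCost θ' ≤ ∫⁻ p, crossGap P Q p) : θ = θ' := by
  have key : ∀ {ρ : Measure (ℝ × ℝ)}, IsPlan P Q ρ →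
      planCost quadCost ρ ≤ ∫⁻ p, crossGap P Q p → ∀ᵐ p : ℝ × ℝ,
        ρ {z | z.1 ≤ p.1 ∧ z.2 ≤ p.2} =
          P (Set.Iic p.1) - (P (Set.Iic p.1) - Q (Set.Iic p.2)) := by
    intro ρ hρ hcρ
    have := hρ.isProbabilityMeasure
    rw [planCost_quadCost_eq] at hcρ
    have hm : Measurable fun p => ρ (upCross p) + ρ (downCross p) :=
      (measurable_measure_prodMk_left measurableSet_upCross_prod).add
        (measurable_measure_prodMk_left measurableSet_downCross_prod)
    filter_upwards [ae_eq_of_ae_le_of_lintegral_le (ae_of_all _ hρ.crossGap_le) hfin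
      hm.aemeasurable hcρ] with p hp
    exact hρ.measure_rect_of_eq hp
  have := h.isProbabilityMeasure
  have := h'.isProbabilityMeasure
  have e1 := key h hc
  have e2 := key h' hc'
  refine ext_of_rect fun a b => le_antisymm (measure_rect_le_of_ae ?_ a b)
    (measure_rect_le_of_ae ?_ a b)
  · filter_upwards [e1, e2] with p hp hp'
    rw [hp, hp']
  · filter_upwards [e1, e2] with p hp hp'
    rw [hp, hp']

end Line

/-! ### The monotone coupling -/

/-- The quantile function of a law on the line, extended by zero outside of `(0, 1)`. -/
def quantile (P : ProbabilityMeasure ℝ) (u : ℝ) : ℝ :=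
  if u ∈ Set.Ioo (0 : ℝ) 1 then sInf {x | u ≤ cdf (P : Measure ℝ) x} else 0

/-- The quantile function and the distribution function form a Galois connection, by right
continuity of the latter. -/
theorem quantile_le_iff (P : ProbabilityMeasure ℝ) {u : ℝ} (hu : u ∈ Set.Ioo (0 : ℝ) 1) (x : ℝ) :
    quantile P u ≤ x ↔ u ≤ cdf (P : Measure ℝ) x := by
  have hne : {x | u ≤ cdf (P : Measure ℝ) x}.Nonempty :=
    ((tendsto_cdf_atTop (P : Measure ℝ)).eventually (eventually_ge_nhds hu.2)).exists
  have hbdd : BddBelow {x | u ≤ cdf (P : Measure ℝ) x} := by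
    obtain ⟨y, hy⟩ :=
      ((tendsto_cdf_atBot (P : Measure ℝ)).eventually (eventually_lt_nhds hu.1)).exists
    refine ⟨y, fun x hx => ?_⟩
    by_contra! h
    exact absurd (hx.trans (monotone_cdf _ h.le)) (not_le.2 hy)
  rw [quantile, if_pos hu]
  constructor
  · intro h
    have hr : Tendsto (cdf (P : Measure ℝ)) (𝓝[>] x) (𝓝 (cdf (P : Measure ℝ) x)) :=
      ((cdf (P : Measure ℝ)).right_continuous x).tendsto.mono_left
        (nhdsWithin_mono _ Set.Ioi_subset_Ici_self)
    refine ge_of_tendsto hr ?_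
    filter_upwards [self_mem_nhdsWithin] with y hy
    obtain ⟨z, hz, hzy⟩ := exists_lt_of_csInf_lt hne (h.trans_lt hy)
    exact le_trans hz (monotone_cdf _ hzy.le)
  · exact fun h => csInf_le hbdd h

theorem measurable_cdf_apply (x : ℝ) :
    Measurable fun P : ProbabilityMeasure ℝ => cdf (P : Measure ℝ) x := by
  simp_rw [cdf_eq_real, measureReal_def]
  exact ((Measure.measurable_coe measurableSet_Iic).comp measurable_subtype_coe).ennreal_toReal

theorem measurable_quantile :
    Measurable fun w : ProbabilityMeasure ℝ × ℝ => quantile w.1 w.2 := by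
  refine measurable_of_Iic fun x => ?_
  have h1 : MeasurableSet {w : ProbabilityMeasure ℝ × ℝ | w.2 ∈ Set.Ioo (0 : ℝ) 1} :=
    measurable_snd measurableSet_Ioo
  have h2 : MeasurableSet {w : ProbabilityMeasure ℝ × ℝ | w.2 ≤ cdf (w.1 : Measure ℝ) x} :=
    measurableSet_le measurable_snd ((measurable_cdf_apply x).comp measurable_fst)
  have : (fun w : ProbabilityMeasure ℝ × ℝ => quantile w.1 w.2) ⁻¹' Set.Iic x =
      {w | w.2 ∈ Set.Ioo (0 : ℝ) 1}.ite {w | w.2 ≤ cdf (w.1 : Measure ℝ) x} {_w | 0 ≤ x} := by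
    ext w
    by_cases hw : w.2 ∈ Set.Ioo (0 : ℝ) 1
    · simp only [Set.mem_preimage, Set.mem_Iic, quantile_le_iff _ hw, Set.ite, Set.mem_union,
        Set.mem_inter_iff, Set.mem_sdiff, Set.mem_ofPred_eq, hw]
      tauto
    · simp only [Set.mem_preimage, Set.mem_Iic, quantile, Set.ite, Set.mem_union,
        Set.mem_inter_iff, Set.mem_sdiff, Set.mem_ofPred_eq, hw]
      simp
  rw [this]
  exact h1.ite h2 (MeasurableSet.const _)

theorem measurable_quantile_right (P : ProbabilityMeasure ℝ) : Measurable (quantile P) :=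
  measurable_quantile.comp measurable_prodMk_left

/-- The uniform law on `(0, 1)`. -/
def uniformUnit : Measure ℝ := volume.restrict (Set.Ioo 0 1)

instance : IsProbabilityMeasure uniformUnit := ⟨by simp [uniformUnit]⟩

theorem map_quantile_uniformUnit (P : ProbabilityMeasure ℝ) :
    uniformUnit.map (quantile P) = P := by
  have hq := measurable_quantile_right P
  refine Measure.ext_of_Iic _ _ fun a => ?_
  rw [Measure.map_apply hq measurableSet_Iic, uniformUnit, Measure.restrict_apply
    (hq measurableSet_Iic), ← ofReal_cdf]
  have hs : quantile P ⁻¹' Set.Iic a ∩ Set.Ioo 0 1 =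
      Set.Iic (cdf (P : Measure ℝ) a) ∩ Set.Ioo 0 1 := by
    ext u
    simp only [Set.mem_inter_iff, Set.mem_preimage, Set.mem_Iic]
    exact and_congr_left fun hu => quantile_le_iff P hu a
  rw [hs]
  have h0 := cdf_nonneg (P : Measure ℝ) a
  have h1 := cdf_le_one (P : Measure ℝ) a
  refine le_antisymm ?_ ?_
  · refine (measure_mono (t := Set.Ioc 0 (cdf (P : Measure ℝ) a)) ?_).trans ?_
    · exact fun u hu => ⟨hu.2.1, hu.1⟩
    · simp
  · refine le_trans ?_ (measure_mono (s := Set.Ioo 0 (cdf (P : Measure ℝ) a)) ?_)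
    · simp
    · exact fun u hu => ⟨hu.2.le, hu.1, hu.2.trans_le h1⟩

/-- The monotone coupling of two laws on the line. -/
def monotoneCoupling (w : ProbabilityMeasure ℝ × ProbabilityMeasure ℝ) :
    ProbabilityMeasure (ℝ × ℝ) :=
  ⟨uniformUnit.map fun u => (quantile w.1 u, quantile w.2 u),
    Measure.isProbabilityMeasure_map ((measurable_quantile_right _).prodMk
      (measurable_quantile_right _)).aemeasurable⟩

theorem measurable_quantile_pair (w : ProbabilityMeasure ℝ × ProbabilityMeasure ℝ) :
    Measurable fun u => (quantile w.1 u, quantile w.2 u) :=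
  (measurable_quantile_right _).prodMk (measurable_quantile_right _)

theorem coe_monotoneCoupling (w : ProbabilityMeasure ℝ × ProbabilityMeasure ℝ) :
    (monotoneCoupling w : Measure (ℝ × ℝ)) =
      uniformUnit.map fun u => (quantile w.1 u, quantile w.2 u) := rfl

theorem measurable_monotoneCoupling : Measurable monotoneCoupling := by
  refine Measurable.subtype_mk (Measure.measurable_of_measurable_coe _ fun B hB => ?_)
  simp_rw [Measure.map_apply (measurable_quantile_pair _) hB]
  have hj : Measurable fun z : (ProbabilityMeasure ℝ × ProbabilityMeasure ℝ) × ℝ =>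
      (quantile z.1.1 z.2, quantile z.1.2 z.2) :=
    (measurable_quantile.comp ((measurable_fst.comp measurable_fst).prodMk measurable_snd)).prodMk
      (measurable_quantile.comp ((measurable_snd.comp measurable_fst).prodMk measurable_snd))
  exact measurable_measure_prodMk_left (hj hB)

theorem isPlan_monotoneCoupling (P Q : ProbabilityMeasure ℝ) :
    IsPlan (P : Measure ℝ) (Q : Measure ℝ) (monotoneCoupling (P, Q)) := by
  constructor
  · rw [coe_monotoneCoupling, Measure.map_map measurable_fst (measurable_quantile_pair _)]
    exact map_quantile_uniformUnit P
  · rw [coe_monotoneCoupling, Measure.map_map measurable_snd (measurable_quantile_pair _)]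
    exact map_quantile_uniformUnit Q

/-- By the Galois connection, these levels `u` lie between the distribution function of `Q` at `b`
and that of `P` at `a`. This is the reverse of `IsPlan.sub_le_fst`, so the monotone coupling attains
the lower bound of the cost. -/
theorem uniformUnit_quantile_le_lt (P Q : ProbabilityMeasure ℝ) (a b : ℝ) :
    uniformUnit {u | quantile P u ≤ a ∧ b < quantile Q u} ≤
      (P : Measure ℝ) (Set.Iic a) - (Q : Measure ℝ) (Set.Iic b) := by
  have hm : MeasurableSet {u | quantile P u ≤ a ∧ b < quantile Q u} :=
    (measurableSet_le (measurable_quantile_right P) measurable_const).inter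
      (measurableSet_lt measurable_const (measurable_quantile_right Q))
  rw [uniformUnit, Measure.restrict_apply hm, ← ofReal_cdf, ← ofReal_cdf,
    ← ENNReal.ofReal_sub _ (cdf_nonneg _ _), ← Real.volume_Ioc]
  refine measure_mono ?_
  rintro u ⟨⟨h1, h2⟩, hu⟩
  refine ⟨?_, (quantile_le_iff P hu a).1 h1⟩
  rw [← not_le, quantile_le_iff Q hu] at h2
  exact not_le.1 h2

theorem planCost_monotoneCoupling_le (P Q : ProbabilityMeasure ℝ) :
    planCost quadCost (monotoneCoupling (P, Q) : Measure (ℝ × ℝ)) ≤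
      ∫⁻ p, crossGap (P : Measure ℝ) (Q : Measure ℝ) p := by
  rw [planCost_quadCost_eq]
  refine lintegral_mono fun p => add_le_add ?_ ?_
  · rw [coe_monotoneCoupling, Measure.map_apply (measurable_quantile_pair _)
      (measurableSet_upCross p)]
    exact uniformUnit_quantile_le_lt P Q _ _
  · rw [coe_monotoneCoupling, Measure.map_apply (measurable_quantile_pair _)
      (measurableSet_downCross p)]
    exact uniformUnit_quantile_le_lt Q P _ _

theorem W2sq_le_planCost {P Q : ProbabilityMeasure ℝ} {θ : Measure (ℝ × ℝ)}
    (h : IsPlan (P : Measure ℝ) (Q : Measure ℝ) θ) : W2sq P Q ≤ planCost quadCost θ :=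
  iInf₂_le θ h

theorem lintegral_crossGap (P Q : ProbabilityMeasure ℝ) :
    ∫⁻ p, crossGap (P : Measure ℝ) (Q : Measure ℝ) p = W2sq P Q :=
  le_antisymm (le_iInf₂ fun _ h => h.lintegral_crossGap_le)
    ((W2sq_le_planCost (isPlan_monotoneCoupling P Q)).trans (planCost_monotoneCoupling_le P Q))

theorem planCost_monotoneCoupling (w : ProbabilityMeasure ℝ × ProbabilityMeasure ℝ) :
    planCost quadCost (monotoneCoupling w : Measure (ℝ × ℝ)) = W2sq w.1 w.2 :=
  le_antisymm ((planCost_monotoneCoupling_le w.1 w.2).trans_eq (lintegral_crossGap w.1 w.2))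
    (W2sq_le_planCost (isPlan_monotoneCoupling w.1 w.2))

theorem measurable_quadCost : Measurable fun z : ℝ × ℝ => quadCost z.1 z.2 := by
  unfold quadCost; fun_prop

/-- The infimum ranges over an uncountable family depending on the pair; it is measurable because
the monotone coupling attains it and depends measurably on the pair. -/
theorem measurable_W2sq :
    Measurable fun w : ProbabilityMeasure ℝ × ProbabilityMeasure ℝ => W2sq w.1 w.2 := by
  simp_rw [← planCost_monotoneCoupling]
  exact (Measure.measurable_lintegral measurable_quadCost).comp
    (measurable_subtype_coe.comp measurable_monotoneCoupling)

/-- An optimal plan of finite cost is the monotone coupling. -/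
theorem IsPlan.eq_monotoneCoupling {P Q : ProbabilityMeasure ℝ} {θ : Measure (ℝ × ℝ)}
    (h : IsPlan (P : Measure ℝ) (Q : Measure ℝ) θ) (hc : planCost quadCost θ ≤ W2sq P Q)
    (hfin : W2sq P Q ≠ ∞) : θ = monotoneCoupling (P, Q) := by
  rw [← lintegral_crossGap] at hc hfin
  exact h.eq_of_planCost_le (isPlan_monotoneCoupling P Q) hfin hc
    (planCost_monotoneCoupling_le P Q)

/-! ### Mixtures of i.i.d. laws -/

theorem measure_map_bind {X Y Z : Type*} [MeasurableSpace X] [MeasurableSpace Y] [MeasurableSpace Z]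
    (σ : Measure X) {κ : X → Measure Y} (hκ : Measurable κ) {f : Y → Z} (hf : Measurable f) :
    (σ.bind κ).map f = σ.bind fun x => (κ x).map f := by
  have hκf : Measurable fun x => (κ x).map f := (Measure.measurable_map f hf).comp hκ
  ext A hA
  rw [Measure.map_apply hf hA, Measure.bind_apply (hf hA) hκ.aemeasurable,
    Measure.bind_apply hA hκf.aemeasurable]
  simp_rw [Measure.map_apply hf hA]

theorem measure_bind_map {X Y Z : Type*} [MeasurableSpace X] [MeasurableSpace Y] [MeasurableSpace Z]
    (σ : Measure X) {g : X → Y} (hg : Measurable g) {κ : Y → Measure Z} (hκ : Measurable κ) :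
    (σ.map g).bind κ = σ.bind fun x => κ (g x) := by
  ext A hA
  have hκA : Measurable fun y => κ y A := (Measure.measurable_coe hA).comp hκ
  have hκg : Measurable fun x => κ (g x) := hκ.comp hg
  rw [Measure.bind_apply hA hκ.aemeasurable, Measure.bind_apply hA hκg.aemeasurable,
    lintegral_map hκA hg]

theorem measure_bind_congr_ae {X Y : Type*} [MeasurableSpace X] [MeasurableSpace Y] {σ : Measure X}
    {κ η : X → Measure Y} (hκ : Measurable κ) (hη : Measurable η) (h : ∀ᵐ x ∂σ, κ x = η x) :
    σ.bind κ = σ.bind η := by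
  ext A hA
  rw [Measure.bind_apply hA hκ.aemeasurable, Measure.bind_apply hA hη.aemeasurable]
  refine lintegral_congr_ae ?_
  filter_upwards [h] with x hx
  rw [hx]

theorem exchSeq_bind_iidLaw {E : Type*} [MeasurableSpace E] (Ξ : Measure (ProbabilityMeasure E)) :
    ExchSeq (Ξ.bind iidLaw) := by
  intro s _
  rw [measure_map_bind Ξ (measurable_iidLaw E) (by fun_prop)]
  simp_rw [iidLaw_map_injective _ s.injective]

/-- The push-forward of probability measures under a measurable map. -/
def pushforward {E F : Type*} [MeasurableSpace E] [MeasurableSpace F] {f : E → F}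
    (hf : Measurable f) (θ : ProbabilityMeasure E) : ProbabilityMeasure F :=
  θ.map hf.aemeasurable

theorem measurable_pushforward {E F : Type*} [MeasurableSpace E] [MeasurableSpace F] {f : E → F}
    (hf : Measurable f) : Measurable (pushforward hf) :=
  Measurable.subtype_mk ((Measure.measurable_map f hf).comp measurable_subtype_coe)

theorem map_bind_iidLaw {E F : Type*} [MeasurableSpace E] [MeasurableSpace F] {f : E → F}
    (hf : Measurable f) (Ξ : Measure (ProbabilityMeasure E)) :
    (Ξ.bind iidLaw).map (fun z i => f (z i)) = (Ξ.map (pushforward hf)).bind iidLaw := by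
  rw [measure_map_bind Ξ (measurable_iidLaw E) (by fun_prop),
    measure_bind_map Ξ (measurable_pushforward hf) (measurable_iidLaw F)]
  simp_rw [iidLaw_map_pi _ hf]
  rfl

theorem lintegral_head_bind_iidLaw {E : Type*} [MeasurableSpace E]
    (Ξ : Measure (ProbabilityMeasure E)) {c : E → ℝ≥0∞} (hc : Measurable c) :
    ∫⁻ z, c (z 0) ∂(Ξ.bind iidLaw) = ∫⁻ θ, ∫⁻ e, c e ∂(θ : Measure E) ∂Ξ := by
  have h0 : Measurable fun z : ℕ → E => z 0 := measurable_pi_apply 0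
  have hc0 : Measurable fun z : ℕ → E => c (z 0) := hc.comp h0
  rw [Measure.lintegral_bind (measurable_iidLaw E).aemeasurable hc0.aemeasurable]
  refine lintegral_congr fun θ => ?_
  rw [← iidLaw_map_eval θ 0, lintegral_map hc h0]

/-- Mixing measures of laws on real sequences are unique. -/
theorem eq_of_bind_iidLaw_eq {σ τ : Measure (ProbabilityMeasure ℝ)}
    (h : σ.bind iidLaw = τ.bind iidLaw) : σ = τ := by
  rw [← map_directing_bind_iidLaw σ, h, map_directing_bind_iidLaw]

/-! ### Exchangeable plans -/

/-- A pair of sequences as a sequence of pairs. -/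
def zipSeq (p : (ℕ → ℝ) × (ℕ → ℝ)) : ℕ → ℝ × ℝ := fun i => (p.1 i, p.2 i)

/-- A sequence of pairs as a pair of sequences. -/
def unzipSeq (z : ℕ → ℝ × ℝ) : (ℕ → ℝ) × (ℕ → ℝ) := (fun i => (z i).1, fun i => (z i).2)

theorem measurable_zipSeq : Measurable zipSeq := by unfold zipSeq; fun_prop

theorem measurable_unzipSeq : Measurable unzipSeq := by unfold unzipSeq; fun_prop

theorem measurable_permAct (s : Equiv.Perm ℕ) : Measurable (permAct s) := by
  unfold permAct; fun_prop

theorem measurable_permAct_prod (s : Equiv.Perm ℕ) :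
    Measurable fun p : (ℕ → ℝ) × (ℕ → ℝ) => (permAct s p.1, permAct s p.2) :=
  ((measurable_permAct s).comp measurable_fst).prodMk ((measurable_permAct s).comp measurable_snd)

theorem measurable_firstCoordCost :
    Measurable fun p : (ℕ → ℝ) × (ℕ → ℝ) => firstCoordCost p.1 p.2 := by
  unfold firstCoordCost; fun_prop

theorem ExchPlan.exchSeq_map_zipSeq {π : Measure ((ℕ → ℝ) × (ℕ → ℝ))} (h : ExchPlan π) :
    ExchSeq (π.map zipSeq) := by
  intro s hs
  conv_rhs => rw [← h s hs]
  rw [Measure.map_map (by fun_prop) measurable_zipSeq, Measure.map_map measurable_zipSeq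
    (measurable_permAct_prod s)]
  rfl

theorem ExchSeq.exchPlan_map_unzipSeq {ρ : Measure (ℕ → ℝ × ℝ)} (h : ExchSeq ρ) :
    ExchPlan (ρ.map unzipSeq) := by
  intro s hs
  conv_rhs => rw [← h s hs]
  rw [Measure.map_map (measurable_permAct_prod s) measurable_unzipSeq,
    Measure.map_map measurable_unzipSeq (by fun_prop)]
  rfl

/-- The pair of the marginals of a plan. -/
def marginals (θ : ProbabilityMeasure (ℝ × ℝ)) : ProbabilityMeasure ℝ × ProbabilityMeasure ℝ :=
  (pushforward measurable_fst θ, pushforward measurable_snd θ)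

theorem measurable_marginals : Measurable marginals :=
  (measurable_pushforward measurable_fst).prodMk (measurable_pushforward measurable_snd)

theorem isPlan_marginals (θ : ProbabilityMeasure (ℝ × ℝ)) :
    IsPlan ((marginals θ).1 : Measure ℝ) ((marginals θ).2 : Measure ℝ) θ := ⟨rfl, rfl⟩

theorem marginals_monotoneCoupling (w : ProbabilityMeasure ℝ × ProbabilityMeasure ℝ) :
    marginals (monotoneCoupling w) = w :=
  Prod.ext (Subtype.ext (isPlan_monotoneCoupling w.1 w.2).1)
    (Subtype.ext (isPlan_monotoneCoupling w.1 w.2).2)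

section Plans

variable {μ ν : Measure (ℕ → ℝ)} {σμ σν : Measure (ProbabilityMeasure ℝ)}

/-- Every exchangeable plan is at least as expensive as some plan between the mixing measures. -/
theorem exists_isPlan_planCost_W2sq_le (hμ : IsDeFinettiMixing μ σμ) (hν : IsDeFinettiMixing ν σν)
    [IsProbabilityMeasure μ] {π : Measure ((ℕ → ℝ) × (ℕ → ℝ))} (hπ : IsPlan μ ν π)
    (he : ExchPlan π) :
    ∃ Λ, IsPlan σμ σν Λ ∧ planCost W2sq Λ ≤ planCost firstCoordCost π := by
  have := hπ.isProbabilityMeasure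
  have hp : IsProbabilityMeasure (π.map zipSeq) :=
    Measure.isProbabilityMeasure_map measurable_zipSeq.aemeasurable
  -- De Finetti is applied to sequences of points of the plane; the marginals of `Ξ` are then
  -- identified by uniqueness of mixing measures of real sequences.
  obtain ⟨Ξ, -, hΞ⟩ := he.exchSeq_map_zipSeq.exists_mixing
  have hσμ := (isDeFinettiMixing_iff.1 hμ).2
  have hσν := (isDeFinettiMixing_iff.1 hν).2
  refine ⟨Ξ.map marginals, ⟨?_, ?_⟩, ?_⟩
  · rw [Measure.map_map measurable_fst measurable_marginals]
    refine eq_of_bind_iidLaw_eq ?_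
    rw [hσμ, ← hπ.1]
    refine (map_bind_iidLaw measurable_fst Ξ).symm.trans ?_
    rw [hΞ, Measure.map_map (by fun_prop) measurable_zipSeq]
    rfl
  · rw [Measure.map_map measurable_snd measurable_marginals]
    refine eq_of_bind_iidLaw_eq ?_
    rw [hσν, ← hπ.2]
    refine (map_bind_iidLaw measurable_snd Ξ).symm.trans ?_
    rw [hΞ, Measure.map_map (by fun_prop) measurable_zipSeq]
    rfl
  · have hc : Measurable fun z : ℕ → ℝ × ℝ => quadCost (z 0).1 (z 0).2 :=
      measurable_quadCost.comp (measurable_pi_apply 0)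
    have hcost : planCost firstCoordCost π =
        ∫⁻ θ, planCost quadCost (θ : Measure (ℝ × ℝ)) ∂Ξ := by
      refine Eq.trans ?_ (lintegral_head_bind_iidLaw Ξ measurable_quadCost)
      rw [hΞ, lintegral_map hc measurable_zipSeq]
      rfl
    rw [hcost, planCost, lintegral_map measurable_W2sq measurable_marginals]
    exact lintegral_mono fun θ => W2sq_le_planCost (isPlan_marginals θ)

/-- Every plan between the mixing measures is realized by an exchangeable plan of the same
cost. -/
theorem exists_exchPlan_planCost_eq (hμ : IsDeFinettiMixing μ σμ) (hν : IsDeFinettiMixing ν σν)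
    {Λ : Measure (ProbabilityMeasure ℝ × ProbabilityMeasure ℝ)} (hΛ : IsPlan σμ σν Λ) :
    ∃ π, IsPlan μ ν π ∧ ExchPlan π ∧ planCost firstCoordCost π = planCost W2sq Λ := by
  set Ξ := Λ.map monotoneCoupling with hΞ
  have hmarg : Ξ.map marginals = Λ := by
    rw [hΞ, Measure.map_map measurable_marginals measurable_monotoneCoupling]
    convert Measure.map_id
    exact funext marginals_monotoneCoupling
  refine ⟨(Ξ.bind iidLaw).map unzipSeq, ⟨?_, ?_⟩,
    (exchSeq_bind_iidLaw Ξ).exchPlan_map_unzipSeq, ?_⟩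
  · rw [Measure.map_map measurable_fst measurable_unzipSeq]
    refine (map_bind_iidLaw measurable_fst Ξ).trans ?_
    rw [← (isDeFinettiMixing_iff.1 hμ).2, ← hΛ.1, ← hmarg,
      Measure.map_map measurable_fst measurable_marginals]
    rfl
  · rw [Measure.map_map measurable_snd measurable_unzipSeq]
    refine (map_bind_iidLaw measurable_snd Ξ).trans ?_
    rw [← (isDeFinettiMixing_iff.1 hν).2, ← hΛ.2, ← hmarg,
      Measure.map_map measurable_snd measurable_marginals]
    rfl
  · rw [planCost, lintegral_map measurable_firstCoordCost measurable_unzipSeq]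
    refine (lintegral_head_bind_iidLaw Ξ measurable_quadCost).trans ?_
    have hc : Measurable fun θ : ProbabilityMeasure (ℝ × ℝ) =>
        ∫⁻ e, quadCost e.1 e.2 ∂(θ : Measure (ℝ × ℝ)) :=
      (Measure.measurable_lintegral measurable_quadCost).comp measurable_subtype_coe
    rw [hΞ, lintegral_map hc measurable_monotoneCoupling]
    exact lintegral_congr fun w => planCost_monotoneCoupling w

theorem IsPlan.planCost_firstCoordCost_lt_top (hμ : IsExchMarginal μ) (hν : IsExchMarginal ν)
    {π : Measure ((ℕ → ℝ) × (ℕ → ℝ))} (hπ : IsPlan μ ν π) :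
    planCost firstCoordCost π < ∞ := by
  have hm : Measurable fun x : ℕ → ℝ => ENNReal.ofReal (x 0 ^ 2) := by fun_prop
  have hfin : ∀ {ρ : Measure (ℕ → ℝ)}, IsExchMarginal ρ →
      ∫⁻ x, ENNReal.ofReal (x 0 ^ 2) ∂ρ < ∞ := fun {ρ} hρ => by
    have := hρ.2.2.lintegral_lt_top
    exact this
  have h1 : ∫⁻ p, ENNReal.ofReal (p.1 0 ^ 2) ∂π < ∞ := by
    rw [← lintegral_map hm measurable_fst, hπ.1]
    exact hfin hμ
  have h2 : ∫⁻ p, ENNReal.ofReal (p.2 0 ^ 2) ∂π < ∞ := by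
    rw [← lintegral_map hm measurable_snd, hπ.2]
    exact hfin hν
  have hm1 : Measurable fun p : (ℕ → ℝ) × (ℕ → ℝ) => ENNReal.ofReal (p.1 0 ^ 2) := by fun_prop
  have hm2 : Measurable fun p : (ℕ → ℝ) × (ℕ → ℝ) => ENNReal.ofReal (p.2 0 ^ 2) := by fun_prop
  calc planCost firstCoordCost π
      ≤ ∫⁻ p, 2 * (ENNReal.ofReal (p.1 0 ^ 2) + ENNReal.ofReal (p.2 0 ^ 2)) ∂π := by
        refine lintegral_mono fun p => ?_
        rw [firstCoordCost, ← ENNReal.ofReal_add (sq_nonneg _) (sq_nonneg _),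
          ← ENNReal.ofReal_ofNat, ← ENNReal.ofReal_mul (by norm_num)]
        refine ENNReal.ofReal_le_ofReal ?_
        nlinarith [sq_nonneg (p.1 0 + p.2 0)]
    _ = 2 * (∫⁻ p, ENNReal.ofReal (p.1 0 ^ 2) ∂π + ∫⁻ p, ENNReal.ofReal (p.2 0 ^ 2) ∂π) := by
        rw [lintegral_const_mul' _ _ (by simp), lintegral_add_left hm1]
    _ < ∞ := ENNReal.mul_lt_top (by simp) (ENNReal.add_lt_top.2 ⟨h1, h2⟩)

end Plans

/-! ### Exchangeable maps of i.i.d. sequences -/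

/-- The sequence with given first term and given shift. -/
def consSeq {E : Type*} (w : (ℕ → E) × E) : ℕ → E
  | 0 => w.2
  | i + 1 => w.1 i

theorem measurable_consSeq {E : Type*} [MeasurableSpace E] :
    Measurable (consSeq : (ℕ → E) × E → ℕ → E) := by
  refine measurable_pi_iff.2 fun i => ?_
  cases i with
  | zero => exact measurable_snd
  | succ i => exact (measurable_pi_apply i).comp measurable_fst

/-- The head is independent of the tail; this allows Fubini's theorem to freeze the tail. -/
theorem map_consSeq_prod {E : Type*} [MeasurableSpace E] (θ : ProbabilityMeasure E) :
    ((iidLaw θ).prod (θ : Measure E)).map consSeq = iidLaw θ := by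
  have := Measure.isProbabilityMeasure_map (μ := (iidLaw θ).prod (θ : Measure E))
    measurable_consSeq.aemeasurable
  refine ext_of_initialBoxes fun n A hA => ?_
  have hB : MeasurableSet ((Finset.range n : Set ℕ).pi A) :=
    MeasurableSet.pi (Finset.range n).countable_toSet fun i _ => hA i
  rw [Measure.map_apply measurable_consSeq hB, iidLaw_box θ n hA]
  cases n with
  | zero => simp
  | succ n =>
    have : consSeq ⁻¹' ((Finset.range (n + 1) : Set ℕ).pi A) =
        ((Finset.range n : Set ℕ).pi fun i => A (i + 1)) ×ˢ A 0 := by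
      ext w
      simp only [Set.mem_preimage, Set.mem_prod, Set.mem_pi, Finset.coe_range, Set.mem_Iio]
      constructor
      · exact fun h => ⟨fun i hi => h (i + 1) (by omega), h 0 (by omega)⟩
      · rintro ⟨h1, h0⟩ (_ | i) hi
        exacts [h0, h1 i (by omega)]
    rw [this, Measure.prod_prod, iidLaw_box θ n fun i => hA (i + 1), Finset.prod_range_succ']

theorem measurableSet_eq_probabilityMeasure (m : ProbabilityMeasure ℝ) :
    MeasurableSet {m' : ProbabilityMeasure ℝ | m' = m} := by
  have : {m' : ProbabilityMeasure ℝ | m' = m} =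
      (fun (m' : ProbabilityMeasure ℝ) (q : ℚ) => cdf (m' : Measure ℝ) q) ⁻¹'
        {fun q : ℚ => cdf (m : Measure ℝ) q} := by
    ext m'
    simp only [Set.mem_ofPred_eq, Set.mem_preimage, Set.mem_singleton_iff]
    refine ⟨fun h => by rw [h], fun h => ?_⟩
    rw [← ofRatCDF_cdf m', h, ofRatCDF_cdf]
  have hm : Measurable fun (m' : ProbabilityMeasure ℝ) (q : ℚ) => cdf (m' : Measure ℝ) q :=
    measurable_pi_iff.2 fun q => measurable_cdf_apply q
  rw [this]
  exact hm (measurableSet_singleton _)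

theorem measurable_graph {X Y : Type*} [MeasurableSpace X] [MeasurableSpace Y] {f : X → Y}
    (hf : Measurable f) : Measurable fun x => (x, f x) := measurable_id.prodMk hf

/-- The graph of an exchangeable map transports exchangeable laws to exchangeable laws. -/
theorem ExchMap.exchPlan_graph {T : (ℕ → ℝ) → (ℕ → ℝ)} (hT : ExchMap T) (hTm : Measurable T)
    {μ : Measure (ℕ → ℝ)} (hμ : ExchMeasure μ) : ExchPlan (μ.map fun x => (x, T x)) := by
  intro s hs
  have hg : Measurable fun x => (x, T x) := measurable_graph hTm
  conv_rhs => rw [← hμ s hs, Measure.map_map hg (measurable_permAct s)]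
  rw [Measure.map_map (measurable_permAct_prod s) hg]
  congr 1
  funext x
  simp only [Function.comp_apply, hT s hs x]

/-- An exchangeable map acts coordinatewise on almost every i.i.d. sequence. -/
theorem ExchMap.exists_coordinatewise {T : (ℕ → ℝ) → (ℕ → ℝ)} (hT : ExchMap T)
    (hTm : Measurable T) (m : ProbabilityMeasure ℝ) :
    ∃ t : ℝ → ℝ, Measurable t ∧ ∀ᵐ x ∂iidLaw m, ∀ i, T x i = t (x i) := by
  have hT0 : Measurable fun x => T x 0 := (measurable_pi_apply 0).comp hTm
  have hg : Measurable fun x => (x, T x) := measurable_graph hTm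
  have hz : Measurable fun x => zipSeq (x, T x) := measurable_zipSeq.comp hg
  set ρ := (iidLaw m).map fun x => zipSeq (x, T x) with hρ
  have hρp : IsProbabilityMeasure ρ := Measure.isProbabilityMeasure_map hz.aemeasurable
  have hρe : ExchSeq ρ := by
    have := (hT.exchPlan_graph hTm (exchSeq_iidLaw m)).exchSeq_map_zipSeq
    rwa [Measure.map_map measurable_zipSeq hg] at this
  obtain ⟨Ξ, hΞp, hΞ⟩ := hρe.exists_mixing
  have hfst : Measurable fun (z : ℕ → ℝ × ℝ) i => (z i).1 := by fun_prop
  -- almost every component has first marginal `m`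
  have h1 : ∀ᵐ θ ∂Ξ, pushforward measurable_fst θ = m := by
    -- The first sequence has law `m^∞`, whose mixing measure is the Dirac mass at `m`, by
    -- uniqueness.
    have : Ξ.map (pushforward measurable_fst) = Measure.dirac m := by
      refine eq_of_bind_iidLaw_eq ?_
      rw [Measure.dirac_bind (measurable_iidLaw ℝ), ← map_bind_iidLaw measurable_fst, hΞ, hρ,
        Measure.map_map hfst hz]
      exact Measure.map_id
    have hd : ∀ᵐ m' ∂(Ξ.map (pushforward measurable_fst)), m' = m := by
      rw [this, ae_dirac_iff (measurableSet_eq_probabilityMeasure m)]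
    rwa [ae_map_iff (measurable_pushforward measurable_fst).aemeasurable
      (measurableSet_eq_probabilityMeasure m)] at hd
  -- and almost every component lives on the graph of `T`
  have hN : MeasurableSet {z : ℕ → ℝ × ℝ | (z 0).2 = T (fun i => (z i).1) 0} :=
    measurableSet_eq_fun (measurable_snd.comp (measurable_pi_apply 0)) (hT0.comp hfst)
  have h2 : ∀ᵐ θ ∂Ξ, ∀ᵐ z ∂iidLaw θ, (z 0).2 = T (fun i => (z i).1) 0 := by
    have hae : ∀ᵐ z ∂ρ, (z 0).2 = T (fun i => (z i).1) 0 := by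
      rw [hρ, ae_map_iff hz.aemeasurable hN]
      exact ae_of_all _ fun x => rfl
    rw [← hΞ] at hae
    exact Measure.ae_ae_of_ae_bind (measurable_iidLaw _).aemeasurable hae
  -- A single component is enough: under `θ^∞` the first sequence already has the full law `m^∞`,
  -- and the final claim concerns that sequence alone.
  obtain ⟨θ, hθ1, hθ2⟩ := (h1.and h2).exists
  have h3 : ∀ᵐ y ∂iidLaw θ, ∀ᵐ e ∂(θ : Measure (ℝ × ℝ)),
      e.2 = T (consSeq (fun i => (y i).1, e.1)) 0 := by
    have h : ∀ᵐ z ∂((iidLaw θ).prod (θ : Measure (ℝ × ℝ))).map consSeq,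
        (z 0).2 = T (fun i => (z i).1) 0 := by rwa [map_consSeq_prod]
    rw [ae_map_iff measurable_consSeq.aemeasurable hN] at h
    filter_upwards [Measure.ae_ae_of_ae_prod h] with y hy
    filter_upwards [hy] with e he
    have hcons : (fun i => (consSeq (y, e) i).1) = consSeq (fun i => (y i).1, e.1) := by
      funext i
      cases i <;> rfl
    rw [hcons] at he
    exact he
  -- For one frozen tail `y`, the law `θ` of the head pair is carried by a graph; `θ` does not
  -- depend on `y`.
  obtain ⟨y, hy⟩ := h3.exists
  let t : ℝ → ℝ := fun s => T (consSeq (fun i => (y i).1, s)) 0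
  have ht : Measurable t := hT0.comp (measurable_consSeq.comp measurable_prodMk_left)
  have h4 : ∀ᵐ z ∂iidLaw θ, (z 0).2 = t (z 0).1 := by
    have hm : MeasurableSet {e : ℝ × ℝ | e.2 = t e.1} :=
      measurableSet_eq_fun measurable_snd (ht.comp measurable_fst)
    have : ∀ᵐ e ∂(iidLaw θ).map (fun z => z 0), e.2 = t e.1 := by rwa [iidLaw_map_eval]
    have h0 : Measurable fun z : ℕ → ℝ × ℝ => z 0 := measurable_pi_apply 0
    rwa [ae_map_iff h0.aemeasurable hm] at this
  have h5 : ∀ᵐ x ∂iidLaw m, T x 0 = t (x 0) := by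
    have hm : MeasurableSet {x : ℕ → ℝ | T x 0 = t (x 0)} :=
      measurableSet_eq_fun hT0 (ht.comp (measurable_pi_apply 0))
    have hlaw : iidLaw m = (iidLaw θ).map fun z i => (z i).1 := by
      rw [← hθ1]
      exact (iidLaw_map_pi θ measurable_fst).symm
    rw [hlaw, ae_map_iff hfst.aemeasurable hm]
    filter_upwards [hθ2, h4] with z hz1 hz2
    rw [← hz1, hz2]
  -- Equivariance under the swap of `0` and `i` transfers the formula to coordinate `i`.
  refine ⟨t, ht, ae_all_iff.2 fun i => ?_⟩
  have hs := isFinitaryPerm_swap 0 i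
  have hm : MeasurableSet {x : ℕ → ℝ | T x 0 = t (x 0)} :=
    measurableSet_eq_fun hT0 (ht.comp (measurable_pi_apply 0))
  have hinv : (iidLaw m).map (permAct (Equiv.swap 0 i)) = iidLaw m := exchSeq_iidLaw m _ hs
  rw [← hinv, ae_map_iff (measurable_permAct _).aemeasurable hm] at h5
  filter_upwards [h5] with x hx
  rw [hT _ hs] at hx
  simpa [permAct] using hx

/-! ### Passing between exchangeable maps and maps of mixing measures -/

section Reduction

variable {μ ν : Measure (ℕ → ℝ)} {σμ σν : Measure (ProbabilityMeasure ℝ)}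

theorem lintegral_firstCoordCost_graph (hμ : IsDeFinettiMixing μ σμ) {T : (ℕ → ℝ) → (ℕ → ℝ)}
    (hTm : Measurable T) :
    planCost firstCoordCost (μ.map fun x => (x, T x)) =
      ∫⁻ m, ∫⁻ x, quadCost (x 0) (T x 0) ∂iidLaw m ∂σμ := by
  have hg : Measurable fun x => (x, T x) := measurable_graph hTm
  have hc : Measurable fun x => firstCoordCost (x, T x).1 (x, T x).2 :=
    measurable_firstCoordCost.comp hg
  rw [planCost, lintegral_map measurable_firstCoordCost hg, ← (isDeFinettiMixing_iff.1 hμ).2,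
    Measure.lintegral_bind (measurable_iidLaw ℝ).aemeasurable
      hc.aemeasurable]
  rfl

theorem isPlan_graph {X Y : Type} [MeasurableSpace X] [MeasurableSpace Y] {P : Measure X}
    {Q : Measure Y} {f : X → Y} (hf : Measurable f) (h : P.map f = Q) :
    IsPlan P Q (P.map fun x => (x, f x)) := by
  have hg : Measurable fun x => (x, f x) := measurable_graph hf
  refine ⟨?_, ?_⟩
  · rw [Measure.map_map measurable_fst hg]
    exact Measure.map_id
  · rw [Measure.map_map measurable_snd hg]
    exact h

theorem IsPlan.map_eq_of_graph {X Y : Type} [MeasurableSpace X] [MeasurableSpace Y]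
    {P : Measure X} {Q : Measure Y} {f : X → Y} (hf : Measurable f)
    (h : IsPlan P Q (P.map fun x => (x, f x))) : P.map f = Q := by
  rw [← h.2, Measure.map_map measurable_snd (measurable_graph hf)]
  rfl

theorem planCost_graph {X Y : Type} [MeasurableSpace X] [MeasurableSpace Y] (P : Measure X)
    {c : X → Y → ℝ≥0∞} (hc : Measurable fun p : X × Y => c p.1 p.2) {f : X → Y}
    (hf : Measurable f) : planCost c (P.map fun x => (x, f x)) = ∫⁻ x, c x (f x) ∂P := by
  rw [planCost, lintegral_map hc (measurable_graph hf)]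

/-- A solution of the exchangeable Monge problem induces a solution of the Monge problem between
the mixing measures and solutions between the components. -/
theorem IsExchMongeSolution.exists_isMongeSolution (hμ : IsExchMarginal μ) (hν : IsExchMarginal ν)
    (hσμ : IsDeFinettiMixing μ σμ) (hσν : IsDeFinettiMixing ν σν) {T : (ℕ → ℝ) → (ℕ → ℝ)}
    (hT : IsExchMongeSolution μ ν T) :
    ∃ S : ProbabilityMeasure ℝ → ProbabilityMeasure ℝ, IsMongeSolution W2sq σμ σν S ∧
      ∀ᵐ (m : ProbabilityMeasure ℝ) ∂σμ, ∃ t : ℝ → ℝ,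
        IsMongeSolution quadCost (m : Measure ℝ) (S m : Measure ℝ) t := by
  obtain ⟨hTm, hTe, hplan, -, hmin⟩ := hT
  have hT0 : Measurable fun x => T x 0 := (measurable_pi_apply 0).comp hTm
  choose t htm ht using hTe.exists_coordinatewise hTm
  -- Defined through `T` rather than through `t m`: the maps `t m` are chosen separately for each
  -- `m`, with no measurability in `m`.
  let S : ProbabilityMeasure ℝ → ProbabilityMeasure ℝ := fun m =>
    ⟨(iidLaw m).map fun x => T x 0, Measure.isProbabilityMeasure_map hT0.aemeasurable⟩
  have hS : Measurable S :=
    ((Measure.measurable_map _ hT0).comp (measurable_iidLaw ℝ)).subtype_mk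
  have hSt : ∀ m, S m = pushforward (htm m) m := by
    intro m
    apply Subtype.ext
    change (iidLaw m).map (fun x => T x 0) = (m : Measure ℝ).map (t m)
    have : (fun x => T x 0) =ᵐ[iidLaw m] fun x => t m (x 0) := by
      filter_upwards [ht m] with x hx using hx 0
    rw [Measure.map_congr this, ← iidLaw_map_eval m 0,
      Measure.map_map (htm m) (measurable_pi_apply 0)]
    rfl
  have hlaw : ∀ m, (iidLaw m).map T = iidLaw (S m) := by
    intro m
    have : T =ᵐ[iidLaw m] fun x i => t m (x i) := by
      filter_upwards [ht m] with x hx using funext hx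
    rw [Measure.map_congr this, iidLaw_map_pi m (htm m), hSt]
    rfl
  have hSσ : σμ.map S = σν := by
    refine eq_of_bind_iidLaw_eq ?_
    rw [measure_bind_map σμ hS (measurable_iidLaw ℝ), (isDeFinettiMixing_iff.1 hσν).2,
      ← hplan.map_eq_of_graph hTm, ← (isDeFinettiMixing_iff.1 hσμ).2,
      measure_map_bind σμ (measurable_iidLaw ℝ) hTm]
    simp_rw [hlaw]
  have hcost : ∀ m : ProbabilityMeasure ℝ,
      planCost quadCost ((m : Measure ℝ).map fun s => (s, t m s)) =
        ∫⁻ x, quadCost (x 0) (T x 0) ∂iidLaw m := by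
    intro m
    have hq : Measurable fun s => quadCost s (t m s) :=
      measurable_quadCost.comp (measurable_id.prodMk (htm m))
    rw [planCost_graph _ measurable_quadCost (htm m)]
    conv_lhs => rw [← iidLaw_map_eval m 0, lintegral_map hq (measurable_pi_apply 0)]
    refine lintegral_congr_ae ?_
    filter_upwards [ht m] with x hx
    rw [hx 0]
  have hplant : ∀ m : ProbabilityMeasure ℝ,
      IsPlan (m : Measure ℝ) (S m : Measure ℝ) ((m : Measure ℝ).map fun s => (s, t m s)) :=
    fun m => isPlan_graph (htm m) (by rw [hSt]; rfl)
  have hle : ∀ m, W2sq m (S m) ≤ ∫⁻ x, quadCost (x 0) (T x 0) ∂iidLaw m := fun m => by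
    rw [← hcost]
    exact W2sq_le_planCost (hplant m)
  have hplanS := isPlan_graph hS hSσ
  have hcS : planCost W2sq (σμ.map fun m => (m, S m)) = ∫⁻ m, W2sq m (S m) ∂σμ :=
    planCost_graph σμ measurable_W2sq hS
  have hcT := lintegral_firstCoordCost_graph hσμ hTm
  have hST : planCost W2sq (σμ.map fun m => (m, S m)) ≤
      planCost firstCoordCost (μ.map fun x => (x, T x)) := by
    rw [hcS, hcT]
    exact lintegral_mono hle
  have hTΛ : ∀ Λ, IsPlan σμ σν Λ →
      planCost firstCoordCost (μ.map fun x => (x, T x)) ≤ planCost W2sq Λ := by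
    intro Λ hΛ
    obtain ⟨π, hπ, he, hπc⟩ := exists_exchPlan_planCost_eq hσμ hσν hΛ
    rw [← hπc]
    exact hmin π hπ he
  refine ⟨S, ⟨hS, hplanS, fun Λ hΛ => hST.trans (hTΛ Λ hΛ)⟩, ?_⟩
  have hfin : ∫⁻ m, W2sq m (S m) ∂σμ ≠ ∞ := by
    rw [← hcS]
    exact (hST.trans_lt (hplan.planCost_firstCoordCost_lt_top hμ hν)).ne
  have hmeas : Measurable fun m => ∫⁻ x, quadCost (x 0) (T x 0) ∂iidLaw m :=
    (Measure.measurable_lintegral (measurable_quadCost.comp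
      ((measurable_pi_apply 0).prodMk hT0))).comp (measurable_iidLaw ℝ)
  have hge := hTΛ _ hplanS
  rw [hcS, hcT] at hge
  -- Componentwise `W₂²` is at most the cost of `t m`; the integrals agree and are finite, so almost
  -- every `t m` is optimal.
  filter_upwards [ae_eq_of_ae_le_of_lintegral_le (ae_of_all _ hle) hfin hmeas.aemeasurable hge]
    with m hm
  refine ⟨t m, htm m, hplant m, fun θ hθ => ?_⟩
  rw [hcost, ← hm]
  exact W2sq_le_planCost hθ

/-- A jointly measurable choice of the maps whose graphs carry the monotone couplings. -/
theorem exists_measurable_transport {S : ProbabilityMeasure ℝ → ProbabilityMeasure ℝ}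
    (hS : Measurable S) :
    ∃ t : ProbabilityMeasure ℝ × ℝ → ℝ, Measurable t ∧
      ∀ (m : ProbabilityMeasure ℝ) (t₀ : ℝ → ℝ), Measurable t₀ →
        (m : Measure ℝ).map (fun s => (s, t₀ s)) = monotoneCoupling (m, S m) →
        (m : Measure ℝ).map (fun s => (s, t (m, s))) = monotoneCoupling (m, S m) := by
  let κ : Kernel (ProbabilityMeasure ℝ) (ℝ × ℝ) :=
    ⟨fun m => monotoneCoupling (m, S m), measurable_subtype_coe.comp
      (measurable_monotoneCoupling.comp (measurable_id.prodMk hS))⟩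
  have hκ : IsMarkovKernel κ := ⟨fun m => inferInstanceAs
    (IsProbabilityMeasure (monotoneCoupling (m, S m) : Measure (ℝ × ℝ)))⟩
  -- The conditional mean is jointly measurable, and where the conditional law is the Dirac mass at
  -- `t₀ s` it equals `t₀ s`.
  let t : ProbabilityMeasure ℝ × ℝ → ℝ := fun w => ∫ y, y ∂κ.condKernel w
  have ht : Measurable t :=
    (StronglyMeasurable.integral_kernel (f := fun y : ℝ => y)
      measurable_id.stronglyMeasurable).measurable
  refine ⟨t, ht, fun m t₀ ht₀ h => ?_⟩
  have hm₀ : MeasurableSet {e : ℝ × ℝ | e.2 = t₀ e.1} :=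
    measurableSet_eq_fun measurable_snd (ht₀.comp measurable_fst)
  rw [← h]
  refine Measure.map_congr ?_
  have hfst : κ.fst m = m := by
    rw [Kernel.fst_apply]
    exact (isPlan_monotoneCoupling m (S m)).1
  have hae : ∀ᵐ e ∂(κ.fst ⊗ₖ κ.condKernel) m, e.2 = t₀ e.1 := by
    rw [κ.disintegrate κ.condKernel]
    change ∀ᵐ e ∂(monotoneCoupling (m, S m) : Measure (ℝ × ℝ)), e.2 = t₀ e.1
    rw [← h, ae_map_iff (measurable_graph ht₀).aemeasurable hm₀]
    exact ae_of_all _ fun _ => rfl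
  have := Kernel.ae_ae_of_ae_compProd hae
  rw [hfst] at this
  filter_upwards [this] with s hs
  have : t (m, s) = t₀ s := by
    have hi : t (m, s) = ∫ _, t₀ s ∂κ.condKernel (m, s) := integral_congr_ae hs
    rw [hi]
    simp
  rw [this]

/-- Solutions of the Monge problems between the mixing measures and between the components induce
a solution of the exchangeable Monge problem. -/
theorem exists_isExchMongeSolution (hμ : IsExchMarginal μ) (hν : IsExchMarginal ν)
    (hσμ : IsDeFinettiMixing μ σμ) (hσν : IsDeFinettiMixing ν σν)
    {S : ProbabilityMeasure ℝ → ProbabilityMeasure ℝ} (hS : IsMongeSolution W2sq σμ σν S)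
    (ht₀ : ∀ᵐ (m : ProbabilityMeasure ℝ) ∂σμ, ∃ t : ℝ → ℝ,
      IsMongeSolution quadCost (m : Measure ℝ) (S m : Measure ℝ) t) :
    ∃ T : (ℕ → ℝ) → (ℕ → ℝ), IsExchMongeSolution μ ν T := by
  obtain ⟨hSm, hplanS, hmin⟩ := hS
  have := hμ.1
  have hcS : planCost W2sq (σμ.map fun m => (m, S m)) = ∫⁻ m, W2sq m (S m) ∂σμ :=
    planCost_graph σμ measurable_W2sq hSm
  have hWm : Measurable fun m => W2sq m (S m) := measurable_W2sq.comp (measurable_id.prodMk hSm)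
  have hfin : ∫⁻ m, W2sq m (S m) ∂σμ ≠ ∞ := by
    obtain ⟨π, hπ, -, hπc⟩ := exists_exchPlan_planCost_eq hσμ hσν hplanS
    rw [← hcS, ← hπc]
    exact (hπ.planCost_firstCoordCost_lt_top hμ hν).ne
  obtain ⟨t, htm, ht⟩ := exists_measurable_transport hSm
  have htr : ∀ m, Measurable fun s => t (m, s) := fun m => htm.comp measurable_prodMk_left
  have hgraph : ∀ᵐ (m : ProbabilityMeasure ℝ) ∂σμ, (m : Measure ℝ).map (fun s => (s, t (m, s))) =
      monotoneCoupling (m, S m) := by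
    filter_upwards [ht₀, ae_lt_top hWm hfin] with m ⟨t₀, ht₀m, hplan, hopt⟩ hlt
    refine ht m t₀ ht₀m (hplan.eq_monotoneCoupling ?_ hlt.ne)
    exact le_iInf₂ hopt
  -- The component is read off the sequence, then its optimal map is applied to every coordinate.
  let T : (ℕ → ℝ) → (ℕ → ℝ) := fun x i => t (directing x, x i)
  have hTm : Measurable T := measurable_pi_iff.2 fun i =>
    htm.comp (measurable_directing.prodMk (measurable_pi_apply i))
  have hTe : ExchMap T := by
    intro s hs x
    funext i
    simp only [T, directing_permAct hs]
    rfl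
  have hTt : ∀ m, ∀ᵐ x ∂iidLaw m, T x = fun i => t (m, x i) := by
    intro m
    filter_upwards [directing_ae_eq m] with x hx
    simp only [T, hx]
  have hlaw : ∀ᵐ (m : ProbabilityMeasure ℝ) ∂σμ, (iidLaw m).map T = iidLaw (S m) := by
    filter_upwards [hgraph] with m hm
    rw [Measure.map_congr (hTt m), iidLaw_map_pi m (htr m)]
    congr 1
    apply Subtype.ext
    change (m : Measure ℝ).map (fun s => t (m, s)) = S m
    rw [← (isPlan_monotoneCoupling m (S m)).2, ← hm,
      Measure.map_map measurable_snd (measurable_graph (htr m))]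
    rfl
  have hmap : μ.map T = ν := by
    rw [← (isDeFinettiMixing_iff.1 hσμ).2, measure_map_bind σμ (measurable_iidLaw ℝ) hTm]
    refine (measure_bind_congr_ae ((Measure.measurable_map T hTm).comp (measurable_iidLaw ℝ))
      ((measurable_iidLaw ℝ).comp hSm) hlaw).trans ?_
    refine (measure_bind_map σμ hSm (measurable_iidLaw ℝ)).symm.trans ?_
    rw [hplanS.map_eq_of_graph hSm, (isDeFinettiMixing_iff.1 hσν).2]
  have hcost : planCost firstCoordCost (μ.map fun x => (x, T x)) =
      planCost W2sq (σμ.map fun m => (m, S m)) := by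
    rw [lintegral_firstCoordCost_graph hσμ hTm, hcS]
    refine lintegral_congr_ae ?_
    filter_upwards [hgraph] with m hm
    have hq : Measurable fun s => quadCost s (t (m, s)) :=
      measurable_quadCost.comp (measurable_graph (htr m))
    rw [← planCost_monotoneCoupling (m, S m), ← hm, planCost_graph _ measurable_quadCost (htr m)]
    conv_rhs => rw [← iidLaw_map_eval m 0, lintegral_map hq (measurable_pi_apply 0)]
    refine lintegral_congr_ae ?_
    filter_upwards [hTt m] with x hx
    rw [hx]
  refine ⟨T, hTm, hTe, isPlan_graph hTm hmap, hTe.exchPlan_graph hTm hμ.2.1,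
    fun π hπ he => ?_⟩
  obtain ⟨Λ, hΛ, hΛc⟩ := exists_isPlan_planCost_W2sq_le hσμ hσν hπ he
  rw [hcost]
  exact (hmin Λ hΛ).trans hΛc

theorem isDeFinettiMixing_dirac (m : ProbabilityMeasure ℝ) :
    IsDeFinettiMixing (countablePower m) (Measure.dirac m) :=
  isDeFinettiMixing_iff.2 ⟨inferInstance, Measure.dirac_bind (measurable_iidLaw ℝ) m⟩

/-- There is no exchangeable optimal map from a countable power to a measure that is not one. -/
theorem not_exists_isExchMongeSolution (hμ : IsExchMarginal μ) (hν : IsExchMarginal ν)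
    (hμp : IsCountablePower μ) (hνp : ¬ IsCountablePower ν) :
    ¬ ∃ T : (ℕ → ℝ) → (ℕ → ℝ), IsExchMongeSolution μ ν T := by
  rintro ⟨T, hT⟩
  obtain ⟨m, rfl⟩ := hμp
  have := hν.1
  obtain ⟨σν, hσν, -⟩ := hν.2.1.existsUnique_isDeFinettiMixing
  obtain ⟨S, ⟨hS, hplan, -⟩, -⟩ :=
    hT.exists_isMongeSolution hμ hν (isDeFinettiMixing_dirac m) hσν
  -- A map cannot split the atom at `m`.
  have hd : Measure.dirac (S m) = σν := by
    rw [← hplan.map_eq_of_graph hS, Measure.map_dirac' hS]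
  refine hνp ⟨S m, ?_⟩
  rw [← (isDeFinettiMixing_iff.1 hσν).2, ← hd, Measure.dirac_bind (measurable_iidLaw ℝ)]
  rfl

end Reduction

/-! ### A pair without exchangeable optimal map -/

/-- The equal mixture of the point masses at the constant sequences `0` and `1`. -/
def coinMixture : Measure (ℕ → ℝ) :=
  (2⁻¹ : ℝ≥0∞) • Measure.dirac (fun _ => 0) + (2⁻¹ : ℝ≥0∞) • Measure.dirac (fun _ => 1)

theorem isExchMarginal_dirac_const (c : ℝ) : IsExchMarginal (Measure.dirac fun _ => c) := by
  refine ⟨inferInstance, fun s _ => ?_, ?_⟩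
  · rw [Measure.map_dirac' (measurable_permAct s)]
    rfl
  · exact integrable_dirac (by simp)

theorem isExchMarginal_coinMixture : IsExchMarginal coinMixture := by
  refine ⟨⟨?_⟩, fun s hs => ?_, ?_⟩
  · simp [coinMixture, ENNReal.inv_two_add_inv_two]
  · rw [coinMixture, Measure.map_add _ _ (measurable_permAct s), Measure.map_smul,
      Measure.map_smul, (isExchMarginal_dirac_const 0).2.1 s hs,
      (isExchMarginal_dirac_const 1).2.1 s hs]
  · exact ((isExchMarginal_dirac_const 0).2.2.smul_measure (by simp)).add_measure
      ((isExchMarginal_dirac_const 1).2.2.smul_measure (by simp))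

theorem isCountablePower_dirac_const (c : ℝ) : IsCountablePower (Measure.dirac fun _ => c) :=
  ⟨⟨Measure.dirac c, inferInstance⟩, (Measure.infinitePi_dirac fun _ : ℕ => c).symm⟩

/-- The first two coordinates agree almost surely, so a power would need `m {0} * m {1} = 0`,
whereas both `m {0} * m {0}` and `m {1} * m {1}` would be `1/2`. -/
theorem not_isCountablePower_coinMixture : ¬ IsCountablePower coinMixture := by
  rintro ⟨m, hm⟩
  have hp : ∀ (A B : Set ℝ), MeasurableSet A → MeasurableSet B →
      coinMixture {x | x 0 ∈ A ∧ x 1 ∈ B} = (m : Measure ℝ) A * (m : Measure ℝ) B := by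
    intro A B hA hB
    have := iidLaw_box m 2 (A := fun i => if i = 0 then A else B)
      (fun i => by split_ifs <;> assumption)
    rw [Finset.prod_range_succ, Finset.prod_range_one, if_pos rfl, if_neg one_ne_zero] at this
    rw [← this, hm]
    change iidLaw m _ = _
    congr 1
    ext x
    simp only [Set.mem_ofPred_eq, Set.mem_pi, Finset.coe_range, Set.mem_Iio]
    constructor
    · rintro ⟨h0, h1⟩ i hi
      interval_cases i
      exacts [h0, h1]
    · exact fun h => ⟨h 0 (by norm_num), h 1 (by norm_num)⟩
  have hmeas : ∀ (A B : Set ℝ), MeasurableSet A → MeasurableSet B →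
      MeasurableSet {x : ℕ → ℝ | x 0 ∈ A ∧ x 1 ∈ B} := fun A B hA hB =>
    (measurable_pi_apply 0 hA).inter (measurable_pi_apply 1 hB)
  have h01 := hp {0} {1} (measurableSet_singleton _) (measurableSet_singleton _)
  have h00 := hp {0} {0} (measurableSet_singleton _) (measurableSet_singleton _)
  have h11 := hp {1} {1} (measurableSet_singleton _) (measurableSet_singleton _)
  simp only [coinMixture, Measure.coe_add, Measure.coe_smul, Pi.add_apply, Pi.smul_apply] at *
  rw [Measure.dirac_apply' _ (hmeas _ _ (measurableSet_singleton _) (measurableSet_singleton _)),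
    Measure.dirac_apply' _ (hmeas _ _ (measurableSet_singleton _) (measurableSet_singleton _))]
    at h01 h00 h11
  simp at h01 h00 h11
  rcases h01 with h | h
  · simp [h] at h00
  · simp [h] at h11

end

theorem corollary1 :
    (∀ μ ν : Measure (ℕ → ℝ), IsExchMarginal μ → IsExchMarginal ν →
      -- the de Finetti mixing measures exist and are unique
      (∃! σ : Measure (ProbabilityMeasure ℝ), IsDeFinettiMixing μ σ) ∧
      (∃! σ : Measure (ProbabilityMeasure ℝ), IsDeFinettiMixing ν σ) ∧
      -- the reduction to the mixing measures and to the components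
      (∀ σμ σν : Measure (ProbabilityMeasure ℝ),
        IsDeFinettiMixing μ σμ → IsDeFinettiMixing ν σν →
        ((∃ T : (ℕ → ℝ) → (ℕ → ℝ), IsExchMongeSolution μ ν T) ↔
          ∃ S : ProbabilityMeasure ℝ → ProbabilityMeasure ℝ,
            IsMongeSolution W2sq σμ σν S ∧
            ∀ᵐ (m : ProbabilityMeasure ℝ) ∂σμ, ∃ t : ℝ → ℝ,
              IsMongeSolution quadCost (m : Measure ℝ) (S m : Measure ℝ) t)) ∧
      -- no map from a countable power to a measure that is not one
      (IsCountablePower μ → ¬ IsCountablePower ν →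
        ¬ ∃ T : (ℕ → ℝ) → (ℕ → ℝ), IsExchMongeSolution μ ν T)) ∧
    -- the exchangeable Monge problem is not always solvable, and a pair as above exists
    (∃ μ ν : Measure (ℕ → ℝ), IsExchMarginal μ ∧ IsExchMarginal ν ∧
      IsCountablePower μ ∧ ¬ IsCountablePower ν ∧
      ¬ ∃ T : (ℕ → ℝ) → (ℕ → ℝ), IsExchMongeSolution μ ν T) := by
  constructor
  · intro μ ν hμ hν
    have := hμ.1
    have := hν.1
    refine ⟨hμ.2.1.existsUnique_isDeFinettiMixing, hν.2.1.existsUnique_isDeFinettiMixing, ?_,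
      not_exists_isExchMongeSolution hμ hν⟩
    intro σμ σν hσμ hσν
    constructor
    · rintro ⟨T, hT⟩
      exact hT.exists_isMongeSolution hμ hν hσμ hσν
    · rintro ⟨S, hS, ht⟩
      exact exists_isExchMongeSolution hμ hν hσμ hσν hS ht
  · exact ⟨Measure.dirac fun _ => 0, coinMixture, isExchMarginal_dirac_const 0,
      isExchMarginal_coinMixture, isCountablePower_dirac_const 0,
      not_isCountablePower_coinMixture,
      not_exists_isExchMongeSolution (isExchMarginal_dirac_const 0) isExchMarginal_coinMixture
        (isCountablePower_dirac_const 0) not_isCountablePower_coinMixture⟩
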